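/- Let $F$ be a global field, i.e. a number field or a finite extension of $\mathbb{F}_p(t)$ for some prime $p$. Let $\mathfrak{o}_F$ be its ring of integers, i.e. the integral closure of $\mathbb{Z}$, respectively of $\mathbb{F}_p[t]$, in $F$; by a prime $\mathfrak{p}$ of $F$ we mean a nonzero prime ideal of $\mathfrak{o}_F$, and $\mathfrak{f}_{\mathfrak{p}}$ denotes its residue field. Let $\varphi \in F(x)$ be a rational function; if $F$ is a number field, assume $\deg\varphi \ge 2$, and if $F$ has positive characteristic, assume that $\varphi$ is nonconstant and has separable degree at least $2$ (the separable degree of $\varphi$ is that of the field extension $F(x)/F(\varphi(x))$; in characteristic $0$ it equals $\deg\varphi$). For $\alpha\in F$ let $\overline{\alpha}\in\mathbb{P}^1(\mathfrak{f}_{\mathfrak{p}})$ be its reduction modulo $\mathfrak{p}$. If $\varphi$ has good reduction $\overline{\varphi}$ at $\mathfrak{p}$, say that $\alpha$ has periodic reduction at $\mathfrak{p}$ if $\overline{\varphi}^{\,n}(\overline{\alpha})=\overline{\alpha}$ for some $n\ge 1$; if $\varphi$ has bad reduction at $\mathfrak{p}$, say that $\alpha$ has periodic reduction at $\mathfrak{p}$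 if the sequence $\left(\overline{\varphi^m(\alpha)}\right)_{m\ge 0}$ in $\mathbb{P}^1(\mathfrak{f}_{\mathfrak{p}})$ is periodic, i.e. for some $n\ge 1$ one has $\overline{\varphi^{m+n}(\alpha)}=\overline{\varphi^{m}(\alpha)}$ for all $m\ge 0$. If $\alpha\in F$ is not periodic under $\varphi$ (that is, $\varphi^n(\alpha)\ne\alpha$ for all $n\ge 1$, where $\varphi$ acts on $\mathbb{P}^1(F)$), then there are infinitely many primes $\mathfrak{p}$ of $F$ at which $\alpha$ does not have periodic reduction. -/

import Mathlib

open Polynomial OnePoint IsDedekindDomain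

noncomputable section

namespace GlobalDynamics

section RationalMaps

variable {K : Type*} [Field K]

/-- The degree of a rational function `f / g` in lowest terms: `max (deg f) (deg g)`. -/
def ratDegree (φ : RatFunc K) : ℕ := max φ.num.natDegree φ.denom.natDegree

/-- The separable degree of a nonconstant rational function `φ`, that is, the separable degree
of the field extension `K(x) / K(φ(x))` that it induces (for constant `φ` this is `0`). -/
def ratSepDegree (φ : RatFunc K) : ℕ :=
  Field.finSepDegree (IntermediateField.adjoin K {φ}) (RatFunc K)

open scoped Classical in
/-- The map `ℙ¹(K) → ℙ¹(K)` of a rational function `φ = f / g` in lowest terms, where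
`ℙ¹(K) = K ∪ {∞}`. In homogeneous coordinates it is `[x : y] ↦ [f*(x, y) : g*(x, y)]`, where
`f*`, `g*` are the homogenizations of `f`, `g` in degree `d = deg φ`; thus `∞ = [1 : 0]` goes to
the quotient of the coefficients of `x ^ d`. -/
def ratMap (φ : RatFunc K) : OnePoint K → OnePoint K
  | OnePoint.some a =>
      if φ.denom.eval a = 0 then ∞ else ((φ.num.eval a / φ.denom.eval a : K) : OnePoint K)
  | ∞ =>
      if φ.denom.coeff (ratDegree φ) = 0 then ∞
      else ((φ.num.coeff (ratDegree φ) / φ.denom.coeff (ratDegree φ) : K) : OnePoint K)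

/-- A point `P` of `ℙ¹(K)` is periodic under `φ` if `φⁿ(P) = P` for some `n ≥ 1`. -/
def IsPeriodicPoint (φ : RatFunc K) (P : OnePoint K) : Prop :=
  ∃ n : ℕ, 1 ≤ n ∧ (ratMap φ)^[n] P = P

end RationalMaps

section Reduction

/-! `o` is the ring of integers of `F`, `𝔭` is a nonzero prime of `o`, and
`𝔭.asIdeal.ResidueField` is the residue field at `𝔭`. -/

variable {o F : Type*} [CommRing o] [Field F] [Algebra o F]

open scoped Classical in
/-- The reduction map `ℙ¹(F) → ℙ¹(𝔣)` at `𝔭`, where `𝔣` is the residue field: an element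
`b / c` of the localization of `o` at `𝔭` (`b, c ∈ o`, `c ∉ 𝔭`) goes to its residue class,
all other points go to `∞`. -/
def reduce (𝔭 : HeightOneSpectrum o) : OnePoint F → OnePoint 𝔭.asIdeal.ResidueField
  | OnePoint.some a =>
      if h : ∃ bc : o × o, bc.2 ∉ 𝔭.asIdeal ∧ a * algebraMap o F bc.2 = algebraMap o F bc.1 then
        ((algebraMap o 𝔭.asIdeal.ResidueField h.choose.1 /
          algebraMap o 𝔭.asIdeal.ResidueField h.choose.2 : 𝔭.asIdeal.ResidueField) :
          OnePoint 𝔭.asIdeal.ResidueField)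
      else ∞
  | ∞ => ∞

/-- The residue class does not depend on the chosen representation `a = b / c`. -/
theorem reduce_coe_of_eq [IsDomain o] [IsFractionRing o F] (𝔭 : HeightOneSpectrum o) (a : F)
    (b c : o) (hc : c ∉ 𝔭.asIdeal) (h : a * algebraMap o F c = algebraMap o F b) :
    reduce 𝔭 (a : OnePoint F) =
      ((algebraMap o 𝔭.asIdeal.ResidueField b / algebraMap o 𝔭.asIdeal.ResidueField c :
        𝔭.asIdeal.ResidueField) : OnePoint 𝔭.asIdeal.ResidueField) := by
  have hex : ∃ bc : o × o, bc.2 ∉ 𝔭.asIdeal ∧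
      a * algebraMap o F bc.2 = algebraMap o F bc.1 := ⟨(b, c), hc, h⟩
  have hred : reduce 𝔭 (a : OnePoint F) =
      ((algebraMap o 𝔭.asIdeal.ResidueField hex.choose.1 /
        algebraMap o 𝔭.asIdeal.ResidueField hex.choose.2 : 𝔭.asIdeal.ResidueField) :
        OnePoint 𝔭.asIdeal.ResidueField) := dif_pos hex
  rw [hred]
  obtain ⟨h1, h2⟩ := hex.choose_spec
  have key : hex.choose.1 * c = b * hex.choose.2 := by
    apply IsFractionRing.injective o F
    rw [map_mul, map_mul, ← h2, ← h]
    ring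
  congr 1
  rw [div_eq_div_iff (by simpa using h1) (by simpa using hc), ← map_mul, ← map_mul, key]

/-- `φ` has good reduction at `𝔭`, and its reduction is `ψ`: after multiplying numerator and
denominator of `φ` by a common nonzero constant they have coefficients in `o`, and the polynomials
obtained by reducing these coefficients modulo `𝔭` are coprime, have quotient `ψ`, and the maximum
of their degrees is still `deg φ` (so the reduced homogeneous forms of degree `deg φ` have no
common zero on `ℙ¹`). -/
def HasGoodReductionTo (φ : RatFunc F) (𝔭 : HeightOneSpectrum o)
    (ψ : RatFunc 𝔭.asIdeal.ResidueField) : Prop :=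
  ∃ (f g : o[X]) (c : F), c ≠ 0 ∧
    f.map (algebraMap o F) = C c * φ.num ∧
    g.map (algebraMap o F) = C c * φ.denom ∧
    g.map (algebraMap o 𝔭.asIdeal.ResidueField) ≠ 0 ∧
    IsCoprime (f.map (algebraMap o 𝔭.asIdeal.ResidueField))
      (g.map (algebraMap o 𝔭.asIdeal.ResidueField)) ∧
    max (f.map (algebraMap o 𝔭.asIdeal.ResidueField)).natDegree
      (g.map (algebraMap o 𝔭.asIdeal.ResidueField)).natDegree = ratDegree φ ∧
    ψ = algebraMap _ (RatFunc 𝔭.asIdeal.ResidueField)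
          (f.map (algebraMap o 𝔭.asIdeal.ResidueField)) /
        algebraMap _ (RatFunc 𝔭.asIdeal.ResidueField)
          (g.map (algebraMap o 𝔭.asIdeal.ResidueField))

/-- `α` has periodic reduction at `𝔭` under `φ`. If `φ` has good reduction, with reduction `ψ`,
this says that the reduction of `α` is periodic under `ψ`. If `φ` has bad reduction at `𝔭`, it says
that the reduced orbit, i.e. the sequence of the reductions of `α, φ(α), φ²(α), …`, is periodic. -/
def HasPeriodicReduction (φ : RatFunc F) (α : F) (𝔭 : HeightOneSpectrum o) : Prop :=
  (∃ ψ, HasGoodReductionTo φ 𝔭 ψ ∧ IsPeriodicPoint ψ (reduce 𝔭 (α : OnePoint F))) ∨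
  ((¬ ∃ ψ, HasGoodReductionTo φ 𝔭 ψ) ∧
    ∃ n : ℕ, 1 ≤ n ∧ ∀ m : ℕ,
      reduce 𝔭 ((ratMap φ)^[m + n] (α : OnePoint F)) =
        reduce 𝔭 ((ratMap φ)^[m] (α : OnePoint F)))

end Reduction

end GlobalDynamics

end

/-!
Suppose that `α` is not periodic, but has periodic reduction outside a finite set of primes.

If the orbit of `α` is finite, reduction is injective on it at almost all primes, so that
periodicity of the reduced orbit forces `α` itself to be periodic; since there are infinitely many
primes, this is a contradiction.

If the orbit is infinite, replace `α` by a point `x₀` further along, so that all `xₘ = φᵐ(x₀)` are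
finite and different from `φ(∞)`. Then `num φ - x₁ · denom φ = (X - x₀)ʲ h` with `h(x₀) ≠ 0`, and
after another shift `h` is not constant: if `φ` were totally ramified over three values, its degree
would be a power of the characteristic exponent and `K(x) / K(φ)` purely inseparable
(`not_three_isTotallyRamifiedAt`).

At a prime of good reduction the reduced map is injective on periodic points. So if `xₘ` reduced to
a root of `h`, then `xₘ₊₁ ≡ x₁`, hence `xₘ ≡ x₀`, which is not a root of `h`. Therefore `1 / h(xₘ)`
and `xₘ / h(xₘ)` are integral at all primes outside a finite set `S`
(`valuation_inv_eval_le_one`). At an absolute value `v` these two elements are bounded unless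
`xₘ₊₁` is `v`-adically close to `x₁` (`exists_abv_inv_eval_le`). Let `V` be the finite set of
absolute values at infinity and above `S`. If `xₘ₊₁` were close to `x₁` at some `v ∈ V` for each of
`|V| + 1` consecutive `m`, the same `v` would occur for `m` and some `m + k`; by continuity of `φᵏ`
then `x₁` would be close to `φᵏ(x₁) = xₖ₊₁ ≠ x₁`, which is impossible
(`exists_forall_le_abv_orbit_sub`). So for infinitely many `m` both elements are bounded at all
`v ∈ V`. There are only finitely many such elements of `F` (`HasFiniteBoundedSets`), so their
quotients `xₘ` take a value twice: a contradiction. No Diophantine approximation is needed.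

The finiteness property and the infinitude of primes are the only facts about global fields used.
In a number field finiteness follows from the bound on conjugates of algebraic integers; in a
function field the absolute values at infinity come from the primes of the integral closure of the
valuation ring of `k(X)` at infinity, and the coefficients of minimal polynomials are bounded.
The extension `F / k(X)` may be inseparable; the integral closures are still Dedekind domains
(`isDedekindDomain_integralClosure`).
-/

namespace GlobalDynamics

/-! ### Totally ramified points -/

section TotallyRamified

variable {K : Type*} [Field K]

/-- The fibre of `φ` over `c` is supported at the single finite point `a`: up to a nonzero
constant, the form `num φ - c · denom φ` is the `deg φ`-th power of `X - a`. -/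
def IsTotallyRamifiedAt (φ : RatFunc K) (a c : K) : Prop :=
  ∃ u : K, u ≠ 0 ∧ φ.num - C c * φ.denom = C u * (X - C a) ^ ratDegree φ

/-- Three `m`-th powers of distinct monic linear polynomials cannot satisfy a linear relation with
nonzero coefficients if `m ≥ 2` is invertible: differentiating gives a second relation, and
eliminating one of the powers leaves two which vanish at different points. -/
theorem no_relation_of_three_powers {m : ℕ} (hm : 2 ≤ m) (hmK : (m : K) ≠ 0) {l₁ l₂ l₃ : K}
    (h₃ : l₃ ≠ 0) {a₁ a₂ a₃ : K} (h13 : a₁ ≠ a₃) (h23 : a₂ ≠ a₃)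
    (h : C l₁ * (X - C a₁) ^ m + C l₂ * (X - C a₂) ^ m + C l₃ * (X - C a₃) ^ m = 0) : False := by
  obtain ⟨k, rfl⟩ : ∃ k, m = k + 1 := ⟨m - 1, by omega⟩
  have hd := congrArg derivative h
  simp only [derivative_add, derivative_mul, derivative_C, derivative_X_sub_C_pow, zero_mul,
    zero_add, add_tsub_cancel_right, derivative_zero] at hd
  have e := congrArg (eval a₂) h
  have ed := congrArg (eval a₂) hd
  have hk : k ≠ 0 := by omega
  simp only [eval_add, eval_mul, eval_C, eval_pow, eval_sub, eval_X, sub_self, eval_zero,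
    zero_pow hk, ne_eq, Nat.succ_ne_zero, not_false_eq_true, zero_pow, mul_zero,
    add_zero] at e ed
  have ed' : l₁ * (a₂ - a₁) ^ k + l₃ * (a₂ - a₃) ^ k = 0 := by
    apply mul_left_cancel₀ hmK
    linear_combination ed
  have : l₃ * (a₂ - a₃) ^ k * (a₁ - a₃) = 0 := by
    linear_combination e - (a₂ - a₁) * ed'
  exact (mul_ne_zero (mul_ne_zero h₃ (pow_ne_zero _ (sub_ne_zero.mpr h23)))
    (sub_ne_zero.mpr h13)) this

/-- If `φ` is totally ramified over three values at finite points, its degree is a power of the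
characteristic exponent. -/
theorem exists_ratDegree_eq_pow (q : ℕ) [ExpChar K q] {φ : RatFunc K} (hd : ratDegree φ ≠ 0)
    {a₁ a₂ a₃ c₁ c₂ c₃ : K} (ha13 : a₁ ≠ a₃) (ha23 : a₂ ≠ a₃) (hc12 : c₁ ≠ c₂)
    (h₁ : IsTotallyRamifiedAt φ a₁ c₁) (h₂ : IsTotallyRamifiedAt φ a₂ c₂)
    (h₃ : IsTotallyRamifiedAt φ a₃ c₃) : ∃ n : ℕ, ratDegree φ = q ^ n := by
  obtain ⟨u₁, hu₁, e₁⟩ := h₁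
  obtain ⟨u₂, hu₂, e₂⟩ := h₂
  obtain ⟨u₃, hu₃, e₃⟩ := h₃
  obtain ⟨n, m, hnm, hm⟩ : ∃ n m : ℕ, ratDegree φ = q ^ n * m ∧ (m : K) ≠ 0 := by
    rcases ‹ExpChar K q› with _ | hp
    · exact ⟨0, ratDegree φ, by simp, by exact_mod_cast hd⟩
    · obtain ⟨n, m, hm, h⟩ := Nat.exists_eq_pow_mul_and_not_dvd hd q hp.ne_one
      exact ⟨n, m, h, fun h0 => hm ((CharP.cast_eq_zero_iff K q m).mp h0)⟩
  have hm0 : m ≠ 0 := by rintro rfl; simp at hm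
  rcases (by omega : m = 1 ∨ 2 ≤ m) with rfl | hm2
  · exact ⟨n, by simpa using hnm⟩
  exfalso
  have hq : 0 < q ^ n := pow_pos (expChar_pos K q) n
  have key : ∀ a : K, (X - C a) ^ (ratDegree φ) =
      expand K (q ^ n) ((X - C (a ^ q ^ n)) ^ m) := fun a => by
    rw [hnm, pow_mul, sub_pow_expChar_pow, map_pow, map_sub, expand_X, expand_C, C_pow]
  have inj : Function.Injective (fun a : K => a ^ q ^ n) := fun a b h =>
    iterateFrobenius_inj K q n h
  rw [key] at e₁ e₂ e₃
  refine no_relation_of_three_powers hm2 hm (l₁ := (c₂ - c₃) * u₁) (l₂ := (c₃ - c₁) * u₂)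
    (l₃ := (c₁ - c₂) * u₃) (mul_ne_zero (sub_ne_zero.mpr hc12) hu₃) (inj.ne ha13) (inj.ne ha23) ?_
  apply expand_injective hq
  simp only [map_add, map_mul, map_sub, expand_C, map_zero] at e₁ e₂ e₃ ⊢
  linear_combination (-(C c₂ - C c₃)) * e₁ - (C c₃ - C c₁) * e₂ - (C c₁ - C c₂) * e₃

/-- If `φ` has degree a power `q ^ n` of the characteristic exponent and is totally ramified over
two values, then `x ^ (q ^ n)` lies in `K(φ)`, so that `K(x) / K(φ)` is purely inseparable. -/
theorem isPurelyInseparable_of_isTotallyRamifiedAt (q : ℕ) [ExpChar K q] {φ : RatFunc K} {n : ℕ}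
    (hd : ratDegree φ = q ^ n) {a₁ a₂ c₁ c₂ : K} (ha : a₁ ≠ a₂) (hc : c₁ ≠ c₂)
    (h₁ : IsTotallyRamifiedAt φ a₁ c₁) (h₂ : IsTotallyRamifiedAt φ a₂ c₂) :
    IsPurelyInseparable (IntermediateField.adjoin K {φ}) (RatFunc K) := by
  set E := IntermediateField.adjoin K {φ} with hE
  obtain ⟨u₁, hu₁, e₁⟩ := h₁
  obtain ⟨u₂, hu₂, e₂⟩ := h₂
  rw [hd] at e₁ e₂
  have : ExpChar (RatFunc K) q := expChar_of_injective_algebraMap (algebraMap K _).injective q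
  have : ExpChar E q := expChar_of_injective_algebraMap (algebraMap K _).injective q
  have hden : algebraMap K[X] (RatFunc K) φ.denom ≠ 0 := by
    simpa using φ.denom_ne_zero
  have hφ : φ * algebraMap K[X] (RatFunc K) φ.denom = algebraMap K[X] (RatFunc K) φ.num := by
    exact ((div_eq_iff hden).mp (RatFunc.num_div_denom φ)).symm
  have f : ∀ a c u : K, φ.num - C c * φ.denom = C u * (X - C a) ^ q ^ n →
      algebraMap K[X] (RatFunc K) φ.denom * (φ - RatFunc.C c) =
        RatFunc.C u * (RatFunc.X ^ q ^ n - RatFunc.C (a ^ q ^ n)) := fun a c u h => by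
    have := congrArg (algebraMap K[X] (RatFunc K)) h
    rw [sub_pow_expChar_pow] at this
    simp only [map_sub, map_mul, map_pow, RatFunc.algebraMap_C, RatFunc.algebraMap_X, ← hφ] at this
    rw [map_pow]
    linear_combination this
  have f₁ := f _ _ _ e₁
  have f₂ := f _ _ _ e₂
  have hCne : RatFunc.C (K := K) c₁ ≠ RatFunc.C c₂ := fun h => hc (RatFunc.C_injective h)
  have hAne : RatFunc.C (K := K) (a₁ ^ q ^ n) ≠ RatFunc.C (a₂ ^ q ^ n) := fun h =>
    ha (iterateFrobenius_inj K q n (RatFunc.C_injective h))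
  have hu₁' : RatFunc.C (K := K) u₁ ≠ 0 := by simpa using hu₁
  have hu₂' : RatFunc.C (K := K) u₂ ≠ 0 := by simpa using hu₂
  set W₁ := RatFunc.C u₁ * (φ - RatFunc.C c₂) with hW₁
  set W₂ := RatFunc.C u₂ * (φ - RatFunc.C c₁) with hW₂
  have g : RatFunc.X ^ q ^ n * (W₁ - W₂) =
      RatFunc.C (a₁ ^ q ^ n) * W₁ - RatFunc.C (a₂ ^ q ^ n) * W₂ := by
    linear_combination (-(φ - RatFunc.C c₂)) * f₁ + (φ - RatFunc.C c₁) * f₂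
  have hφE : φ ∈ E := IntermediateField.mem_adjoin_simple_self K φ
  have hCE : ∀ x : K, RatFunc.C x ∈ E := fun x => E.algebraMap_mem x
  have hW : W₁ - W₂ ≠ 0 := fun h0 => by
    rw [h0, mul_zero] at g
    have h12 : W₁ = W₂ := sub_eq_zero.mp h0
    rw [h12, ← sub_mul] at g
    have : W₂ = 0 := (mul_eq_zero.mp g.symm).resolve_left (sub_ne_zero.mpr hAne)
    rw [this] at h12
    have t₁ := (mul_eq_zero.mp h12).resolve_left hu₁'
    have t₂ := (mul_eq_zero.mp this).resolve_left hu₂'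
    exact hCne (by linear_combination t₁ - t₂)
  have hX : (RatFunc.X : RatFunc K) ^ q ^ n ∈ E := by
    rw [eq_div_of_mul_eq hW g]
    have hW₁E : W₁ ∈ E := E.mul_mem (hCE _) (E.sub_mem hφE (hCE _))
    have hW₂E : W₂ ∈ E := E.mul_mem (hCE _) (E.sub_mem hφE (hCE _))
    exact E.div_mem (E.sub_mem (E.mul_mem (hCE _) hW₁E) (E.mul_mem (hCE _) hW₂E))
      (E.sub_mem hW₁E hW₂E)
  have hpoly : ∀ r : K[X], (algebraMap K[X] (RatFunc K) r) ^ q ^ n ∈ E := fun r => by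
    induction r using Polynomial.induction_on' with
    | add r s hr hs => rw [map_add, add_pow_expChar_pow]; exact E.add_mem hr hs
    | monomial k c =>
      rw [← C_mul_X_pow_eq_monomial, map_mul, map_pow, RatFunc.algebraMap_C, RatFunc.algebraMap_X,
        mul_pow, ← pow_mul, mul_comm k, pow_mul, ← map_pow]
      exact E.mul_mem (hCE _) (pow_mem hX k)
  refine (isPurelyInseparable_iff_pow_mem E q).mpr fun x => ⟨n, ?_⟩
  have : x ^ q ^ n ∈ E := by
    rw [← RatFunc.num_div_denom x, div_pow]
    exact E.div_mem (hpoly _) (hpoly _)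
  exact ⟨⟨_, this⟩, rfl⟩

/-- A map of degree at least `2` in characteristic `0`, or of separable degree at least `2`, is not
totally ramified over three values at finite points. -/
theorem not_three_isTotallyRamifiedAt {φ : RatFunc K} (hd : ratDegree φ ≠ 0)
    (h : (CharZero K ∧ 2 ≤ ratDegree φ) ∨ 2 ≤ ratSepDegree φ)
    {a₁ a₂ a₃ c₁ c₂ c₃ : K} (ha12 : a₁ ≠ a₂) (ha13 : a₁ ≠ a₃) (ha23 : a₂ ≠ a₃) (hc12 : c₁ ≠ c₂)
    (h₁ : IsTotallyRamifiedAt φ a₁ c₁) (h₂ : IsTotallyRamifiedAt φ a₂ c₂) :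
    ¬ IsTotallyRamifiedAt φ a₃ c₃ := by
  intro h₃
  rcases h with ⟨_, h⟩ | h
  · obtain ⟨n, hn⟩ := exists_ratDegree_eq_pow 1 hd ha13 ha23 hc12 h₁ h₂ h₃
    simp only [one_pow] at hn
    omega
  · obtain ⟨q, _⟩ := ExpChar.exists K
    obtain ⟨n, hn⟩ := exists_ratDegree_eq_pow q hd ha13 ha23 hc12 h₁ h₂ h₃
    have := isPurelyInseparable_of_isTotallyRamifiedAt q hn ha12 hc12 h₁ h₂
    rw [ratSepDegree, IsPurelyInseparable.finSepDegree_eq_one] at h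
    omega

end TotallyRamified

/-! ### Homogeneous coordinates and good reduction -/

section HomogeneousCoordinates

/-- The value at `(b, c)` of the homogenization of `h` in degree `d`
(terms of `h` of degree above `d` are discarded). -/
def homEval {R : Type*} [CommRing R] (d : ℕ) (h : R[X]) (b c : R) : R :=
  ∑ i ∈ Finset.range (d + 1), h.coeff i * b ^ i * c ^ (d - i)

theorem homEval_map {R S : Type*} [CommRing R] [CommRing S] (f : R →+* S) (d : ℕ) (h : R[X])
    (b c : R) : homEval d (h.map f) (f b) (f c) = f (homEval d h b c) := by
  simp [homEval, map_sum]

theorem homEval_C_mul {R : Type*} [CommRing R] (d : ℕ) (k : R) (h : R[X]) (b c : R) :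
    homEval d (C k * h) b c = k * homEval d h b c := by
  simp [homEval, Finset.mul_sum, mul_assoc]

theorem homEval_zero_right {R : Type*} [CommRing R] (d : ℕ) (h : R[X]) (b : R) :
    homEval d h b 0 = h.coeff d * b ^ d := by
  rw [homEval, Finset.sum_range_succ, Finset.sum_eq_zero]
  · simp
  · intro i hi
    rw [zero_pow (by have := Finset.mem_range.mp hi; omega), mul_zero]

variable {K : Type*} [Field K]

theorem homEval_of_ne_zero {d : ℕ} {h : K[X]} (hd : h.natDegree ≤ d) (b : K) {c : K} (hc : c ≠ 0) :
    homEval d h b c = c ^ d * h.eval (b / c) := by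
  rw [eval_eq_sum_range' (Nat.lt_succ_of_le hd), homEval, Finset.mul_sum]
  refine Finset.sum_congr rfl fun i hi => ?_
  have hi' : i ≤ d := Nat.lt_succ_iff.mp (Finset.mem_range.mp hi)
  rw [← pow_sub_mul_pow c hi', div_pow]
  field_simp

/-- Two coprime polynomials, one of them of degree exactly `d`, have homogenizations in degree `d`
without a common zero on the projective line. -/
theorem not_homEval_eq_zero {f g : K[X]} (h : IsCoprime f g) {b c : K} (hbc : ¬ (b = 0 ∧ c = 0)) :
    ¬ (homEval (max f.natDegree g.natDegree) f b c = 0 ∧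
      homEval (max f.natDegree g.natDegree) g b c = 0) := by
  rintro ⟨hf, hg⟩
  by_cases hc : c = 0
  · subst hc
    have hb : b ≠ 0 := fun hb => hbc ⟨hb, rfl⟩
    rw [homEval_zero_right] at hf hg
    have hf' := (mul_eq_zero.mp hf).resolve_right (pow_ne_zero _ hb)
    have hg' := (mul_eq_zero.mp hg).resolve_right (pow_ne_zero _ hb)
    have h0 : f = 0 ∨ g = 0 := by
      rcases max_choice f.natDegree g.natDegree with e | e
      · rw [e] at hf'; exact .inl (leadingCoeff_eq_zero.mp hf')
      · rw [e] at hg'; exact .inr (leadingCoeff_eq_zero.mp hg')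
    rcases h0 with rfl | rfl
    · have := natDegree_eq_zero_of_isUnit (isCoprime_zero_left.mp h)
      simp only [natDegree_zero, this, max_self] at hg'
      rw [eq_C_of_natDegree_eq_zero this, hg', C_0] at h
      exact not_isCoprime_zero_zero h
    · have := natDegree_eq_zero_of_isUnit (isCoprime_zero_right.mp h)
      simp only [natDegree_zero, this, max_self] at hf'
      rw [eq_C_of_natDegree_eq_zero this, hf', C_0] at h
      exact not_isCoprime_zero_zero h
  · rw [homEval_of_ne_zero (le_max_left _ _) _ hc] at hf
    rw [homEval_of_ne_zero (le_max_right _ _) _ hc] at hg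
    obtain ⟨u, v, huv⟩ := h
    have := congrArg (eval (b / c)) huv
    simp [(mul_eq_zero.mp hf).resolve_left (pow_ne_zero _ hc),
      (mul_eq_zero.mp hg).resolve_left (pow_ne_zero _ hc)] at this

open scoped Classical in
/-- The point `[b : c]` of `ℙ¹(K) = K ∪ {∞}`; the pair `(0, 0)` is sent to `∞`. -/
noncomputable def projPt (b c : K) : OnePoint K := if c = 0 then ∞ else ((b / c : K) : OnePoint K)

theorem projPt_zero (b : K) : projPt b 0 = ∞ := if_pos rfl

theorem projPt_of_ne_zero (b : K) {c : K} (hc : c ≠ 0) : projPt b c = ((b / c : K) : OnePoint K) :=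
  if_neg hc

theorem projPt_mul_left {k : K} (hk : k ≠ 0) (b c : K) : projPt (k * b) (k * c) = projPt b c := by
  by_cases hc : c = 0
  · rw [hc, mul_zero, projPt_zero, projPt_zero]
  · rw [projPt_of_ne_zero _ hc, projPt_of_ne_zero _ (mul_ne_zero hk hc), mul_div_mul_left _ _ hk]

theorem mul_eq_mul_of_projPt_eq {b c b' c' : K} (h : projPt b c = projPt b' c') :
    b * c' = b' * c := by
  by_cases hc : c = 0 <;> by_cases hc' : c' = 0
  · simp [hc, hc']
  · subst hc
    rw [projPt_zero, projPt_of_ne_zero _ hc'] at h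
    exact absurd h (infty_ne_coe _)
  · subst hc'
    rw [projPt_zero, projPt_of_ne_zero _ hc] at h
    exact absurd h (coe_ne_infty _)
  · rw [projPt_of_ne_zero _ hc, projPt_of_ne_zero _ hc'] at h
    exact (div_eq_div_iff hc hc').mp (OnePoint.coe_injective h)

theorem projPt_eq_of_mul_eq_mul {b c b' c' : K} (h : ¬ (b = 0 ∧ c = 0)) (h' : ¬ (b' = 0 ∧ c' = 0))
    (e : b * c' = b' * c) : projPt b c = projPt b' c' := by
  by_cases hc : c = 0 <;> by_cases hc' : c' = 0
  · rw [hc, hc', projPt_zero, projPt_zero]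
  · simp [hc, hc'] at e; exact absurd ⟨e, hc⟩ h
  · simp [hc, hc'] at e; exact absurd ⟨e, hc'⟩ h'
  · rw [projPt_of_ne_zero _ hc, projPt_of_ne_zero _ hc', (div_eq_div_iff hc hc').mpr e]

theorem ratMap_projPt (φ : RatFunc K) {b c : K} (hbc : ¬ (b = 0 ∧ c = 0)) :
    ratMap φ (projPt b c) =
      projPt (homEval (ratDegree φ) φ.num b c) (homEval (ratDegree φ) φ.denom b c) := by
  classical
  by_cases hc : c = 0
  · subst hc
    have hb : b ^ ratDegree φ ≠ 0 := pow_ne_zero _ fun hb => hbc ⟨hb, rfl⟩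
    rw [homEval_zero_right, homEval_zero_right, mul_comm, mul_comm (φ.denom.coeff _),
      projPt_mul_left hb, projPt_zero]
    rfl
  · have h₁ : φ.num.natDegree ≤ ratDegree φ := le_max_left _ _
    have h₂ : φ.denom.natDegree ≤ ratDegree φ := le_max_right _ _
    rw [homEval_of_ne_zero h₁ _ hc, homEval_of_ne_zero h₂ _ hc,
      projPt_mul_left (pow_ne_zero _ hc), projPt_of_ne_zero _ hc]
    rfl

/-- The numerator and denominator of a quotient of coprime polynomials, up to a constant. -/
theorem exists_num_denom_div {φ : RatFunc K} {f g : K[X]} (hg : g ≠ 0) (h : IsCoprime f g)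
    (hφ : φ = algebraMap K[X] (RatFunc K) f / algebraMap _ _ g) :
    ∃ k : K, k ≠ 0 ∧ f = C k * φ.num ∧ g = C k * φ.denom := by
  have e : φ.num * g = f * φ.denom := (RatFunc.num_mul_eq_mul_denom_iff hg).mpr hφ
  have h1 : φ.denom ∣ g := φ.isCoprime_num_denom.symm.dvd_of_dvd_mul_left ⟨f, by rw [e, mul_comm]⟩
  have h2 : g ∣ φ.denom := h.symm.dvd_of_dvd_mul_left ⟨φ.num, by rw [← e, mul_comm]⟩
  obtain ⟨u, hu⟩ := associated_of_dvd_dvd h1 h2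
  obtain ⟨k, hk, hk'⟩ := isUnit_iff.mp u.isUnit
  have hg' : g = C k * φ.denom := by rw [← hu, ← hk', mul_comm]
  refine ⟨k, hk.ne_zero, ?_, hg'⟩
  apply mul_right_cancel₀ φ.denom_ne_zero
  rw [← e, hg']
  ring

theorem ratMap_projPt_of_eq_div {φ : RatFunc K} {f g : K[X]} (hg : g ≠ 0) (h : IsCoprime f g)
    (hφ : φ = algebraMap K[X] (RatFunc K) f / algebraMap _ _ g) {b c : K}
    (hbc : ¬ (b = 0 ∧ c = 0)) :
    ratMap φ (projPt b c) =
      projPt (homEval (max f.natDegree g.natDegree) f b c)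
        (homEval (max f.natDegree g.natDegree) g b c) := by
  obtain ⟨k, hk, hf, hg'⟩ := exists_num_denom_div hg h hφ
  have hd : max f.natDegree g.natDegree = ratDegree φ := by
    rw [hf, hg', natDegree_C_mul hk, natDegree_C_mul hk]
    rfl
  rw [ratMap_projPt _ hbc, hd, hf, hg', homEval_C_mul, homEval_C_mul, projPt_mul_left hk]

end HomogeneousCoordinates

section GoodReduction

variable {o F : Type*} [CommRing o] [Field F] [Algebra o F]

theorem reduce_projPt [IsDomain o] [IsFractionRing o F] (𝔭 : HeightOneSpectrum o) {b c : o}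
    (h : ¬ (b ∈ 𝔭.asIdeal ∧ c ∈ 𝔭.asIdeal)) :
    reduce 𝔭 (projPt (algebraMap o F b) (algebraMap o F c)) =
      projPt (algebraMap o 𝔭.asIdeal.ResidueField b) (algebraMap o 𝔭.asIdeal.ResidueField c) := by
  have inj := IsFractionRing.injective o F
  by_cases hc : c ∈ 𝔭.asIdeal
  · have hb : b ∉ 𝔭.asIdeal := fun hb => h ⟨hb, hc⟩
    rw [Ideal.algebraMap_residueField_eq_zero.mpr hc, projPt_zero]
    by_cases hc0 : c = 0
    · rw [hc0, map_zero, projPt_zero]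
      rfl
    have hc0' : algebraMap o F c ≠ 0 := (map_ne_zero_iff _ inj).mpr hc0
    rw [projPt_of_ne_zero _ hc0']
    refine dif_neg ?_
    rintro ⟨⟨b₂, c₂⟩, hc₂, e⟩
    have : b * c₂ = b₂ * c := by
      apply inj
      rw [map_mul, map_mul, ← e]
      field_simp
    have hm : b * c₂ ∈ 𝔭.asIdeal := this ▸ Ideal.mul_mem_left _ _ hc
    exact (𝔭.isPrime.mem_or_mem hm).elim hb hc₂
  · have hc0 : c ≠ 0 := fun h0 => hc (h0 ▸ Ideal.zero_mem _)
    have hc0' : algebraMap o F c ≠ 0 := (map_ne_zero_iff _ inj).mpr hc0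
    rw [projPt_of_ne_zero _ hc0', projPt_of_ne_zero _ (by simpa using hc)]
    exact reduce_coe_of_eq 𝔭 _ b c hc (div_mul_cancel₀ _ hc0')

variable [IsDedekindDomain o] [IsFractionRing o F]

/-- Homogeneous coordinates which are integral and coprime at `𝔭`. -/
theorem exists_eq_projPt (𝔭 : HeightOneSpectrum o) (P : OnePoint F) :
    ∃ b c : o, ¬ (b ∈ 𝔭.asIdeal ∧ c ∈ 𝔭.asIdeal) ∧
      P = projPt (algebraMap o F b) (algebraMap o F c) := by
  have inj := IsFractionRing.injective o F
  have ne0 : ∀ d : 𝔭.asIdeal.primeCompl, algebraMap o F d ≠ 0 := fun d =>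
    (map_ne_zero_iff _ inj).mpr fun h0 => d.2 (h0 ▸ Ideal.zero_mem _)
  induction P using OnePoint.rec with
  | infty =>
    refine ⟨1, 0, fun h => 𝔭.isPrime.ne_top ((Ideal.eq_top_iff_one _).mpr h.1), ?_⟩
    rw [map_zero, projPt_zero]
  | coe x =>
    obtain ⟨n, d, h | h⟩ := 𝔭.exists_primeCompl_mul_eq_or_mul_eq x
    · refine ⟨n, d, fun h => d.2 h.2, ?_⟩
      rw [projPt_of_ne_zero _ (ne0 d), ← h, mul_div_cancel_right₀ _ (ne0 d)]
    · have hn : algebraMap o F n ≠ 0 := by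
        intro h0
        rw [h0, mul_zero] at h
        exact ne0 d h.symm
      refine ⟨d, n, fun h => d.2 h.1, ?_⟩
      rw [projPt_of_ne_zero _ hn, ← h, mul_div_cancel_right₀ _ hn]

/-- A rational function with good reduction commutes with reduction. -/
theorem HasGoodReductionTo.reduce_ratMap {φ : RatFunc F} {𝔭 : HeightOneSpectrum o}
    {ψ : RatFunc 𝔭.asIdeal.ResidueField} (h : HasGoodReductionTo φ 𝔭 ψ) (P : OnePoint F) :
    reduce 𝔭 (ratMap φ P) = ratMap ψ (reduce 𝔭 P) := by
  obtain ⟨f, g, k, hk, hf, hg, hg0, hco, hdeg, rfl⟩ := h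
  obtain ⟨b, c, hbc, rfl⟩ := exists_eq_projPt 𝔭 P
  have inj := IsFractionRing.injective o F
  have hbcF : ¬ (algebraMap o F b = 0 ∧ algebraMap o F c = 0) := by
    rintro ⟨h1, h2⟩
    rw [map_eq_zero_iff _ inj] at h1 h2
    exact hbc ⟨h1 ▸ Ideal.zero_mem _, h2 ▸ Ideal.zero_mem _⟩
  have hbcR : ¬ (algebraMap o 𝔭.asIdeal.ResidueField b = 0 ∧
      algebraMap o 𝔭.asIdeal.ResidueField c = 0) := by
    simpa using hbc
  rw [ratMap_projPt φ hbcF, ← projPt_mul_left hk, ← homEval_C_mul, ← homEval_C_mul, ← hf, ← hg,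
    homEval_map, homEval_map, reduce_projPt 𝔭 hbc, ratMap_projPt_of_eq_div hg0 hco rfl hbcR, hdeg,
    homEval_map, homEval_map, reduce_projPt]
  have := not_homEval_eq_zero hco hbcR
  rw [hdeg, homEval_map, homEval_map] at this
  simpa using this

theorem HasGoodReductionTo.reduce_iterate {φ : RatFunc F} {𝔭 : HeightOneSpectrum o}
    {ψ : RatFunc 𝔭.asIdeal.ResidueField} (h : HasGoodReductionTo φ 𝔭 ψ) (P : OnePoint F) (n : ℕ) :
    reduce 𝔭 ((ratMap φ)^[n] P) = (ratMap ψ)^[n] (reduce 𝔭 P) := by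
  induction n with
  | zero => rfl
  | succ n ih =>
    rw [Function.iterate_succ_apply', Function.iterate_succ_apply', h.reduce_ratMap, ih]

theorem finite_setOf_valuation_ne_one {x : F} (hx : x ≠ 0) :
    {𝔭 : HeightOneSpectrum o | 𝔭.valuation F x ≠ 1}.Finite := by
  refine ((HeightOneSpectrum.Support.finite o x).union
    (HeightOneSpectrum.Support.finite o x⁻¹)).subset fun 𝔭 h => ?_
  rcases lt_or_gt_of_ne h with h | h
  · right
    have : 1 < 𝔭.valuation F x⁻¹ := by
      rw [map_inv₀]
      exact (one_lt_inv₀ (zero_lt_iff.mpr ((Valuation.ne_zero_iff _).mpr hx))).mpr h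
    exact this
  · exact .inl h

theorem finite_setOf_one_lt_valuation (x : F) :
    {𝔭 : HeightOneSpectrum o | ¬ 𝔭.valuation F x ≤ 1}.Finite :=
  (HeightOneSpectrum.Support.finite o x).subset fun _ h => not_le.mp h

theorem finite_setOf_mem_asIdeal {x : o} (hx : x ≠ 0) :
    {𝔭 : HeightOneSpectrum o | x ∈ 𝔭.asIdeal}.Finite := by
  have h : algebraMap o (FractionRing o) x ≠ 0 :=
    (map_ne_zero_iff _ (IsFractionRing.injective o _)).mpr hx
  refine (finite_setOf_valuation_ne_one (o := o) h).subset fun 𝔭 hp => ?_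
  exact ((𝔭.valuation_lt_one_iff_mem x).mpr hp).ne

theorem finite_setOf_reduce_eq {P Q : OnePoint F} (h : P ≠ Q) :
    {𝔭 : HeightOneSpectrum o | reduce 𝔭 P = reduce 𝔭 Q}.Finite := by
  have inj := IsFractionRing.injective o F
  have rep : ∀ P : OnePoint F, ∃ b c x : o, x ≠ 0 ∧ (x = b ∨ x = c) ∧
      P = projPt (algebraMap o F b) (algebraMap o F c) := fun P => by
    induction P using OnePoint.rec with
    | infty => exact ⟨1, 0, 1, one_ne_zero, .inl rfl, by rw [map_zero, projPt_zero]⟩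
    | coe x =>
      obtain ⟨b, c, hc, rfl⟩ := IsFractionRing.div_surjective (A := o) x
      have hc0 := nonZeroDivisors.ne_zero hc
      exact ⟨b, c, c, hc0, .inr rfl,
        (projPt_of_ne_zero _ ((map_ne_zero_iff _ inj).mpr hc0)).symm⟩
  obtain ⟨b, c, x, hx0, hx, rfl⟩ := rep P
  obtain ⟨b', c', x', hx0', hx', rfl⟩ := rep Q
  have hne : b * c' - b' * c ≠ 0 := fun h0 => by
    apply h
    have hor : ∀ b c x : o, x ≠ 0 → (x = b ∨ x = c) →
        ¬ (algebraMap o F b = 0 ∧ algebraMap o F c = 0) := by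
      rintro b c x hx0 hx ⟨h1, h2⟩
      rw [map_eq_zero_iff _ inj] at h1 h2
      rcases hx with rfl | rfl
      exacts [hx0 h1, hx0 h2]
    refine projPt_eq_of_mul_eq_mul (hor b c x hx0 hx) (hor b' c' x' hx0' hx') ?_
    rw [← map_mul, ← map_mul, sub_eq_zero.mp h0]
  refine (((finite_setOf_mem_asIdeal hx0).union (finite_setOf_mem_asIdeal hx0')).union
    (finite_setOf_mem_asIdeal hne)).subset fun 𝔭 hp => ?_
  by_contra hcon
  simp only [Set.mem_union, Set.mem_ofPred_eq, not_or] at hcon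
  obtain ⟨⟨h1, h2⟩, h3⟩ := hcon
  have hor : ∀ b c x : o, x ∉ 𝔭.asIdeal → (x = b ∨ x = c) →
      ¬ (b ∈ 𝔭.asIdeal ∧ c ∈ 𝔭.asIdeal) := by
    rintro b c x hx0 (rfl | rfl) ⟨h1, h2⟩
    exacts [hx0 h1, hx0 h2]
  rw [Set.mem_ofPred_eq, reduce_projPt 𝔭 (hor _ _ _ h1 hx),
    reduce_projPt 𝔭 (hor _ _ _ h2 hx')] at hp
  have := mul_eq_mul_of_projPt_eq hp
  rw [← map_mul, ← map_mul, ← sub_eq_zero, ← map_sub] at this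
  exact h3 (Ideal.algebraMap_residueField_eq_zero.mp this)

/-- A rational function has good reduction at almost all primes: those not dividing a Bézout
constant for numerator and denominator, nor certain leading coefficients. -/
theorem finite_setOf_bad_reduction (φ : RatFunc F) :
    {𝔭 : HeightOneSpectrum o | ¬ ∃ ψ, HasGoodReductionTo φ 𝔭 ψ}.Finite := by
  have inj := IsFractionRing.injective o F
  have clear : ∀ h : F[X], ∃ (k : o) (h' : o[X]), k ≠ 0 ∧
      h'.map (algebraMap o F) = C (algebraMap o F k) * h := fun h => by
    obtain ⟨k, hk, e⟩ := IsLocalization.integerNormalization_spec (nonZeroDivisors o) h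
    refine ⟨k, _, nonZeroDivisors.ne_zero hk, e.trans ?_⟩
    rw [← smul_eq_C_mul, algebraMap_smul]
  obtain ⟨k₁, f₁, hk₁, hf₁⟩ := clear φ.num
  obtain ⟨k₂, g₁, hk₂, hg₁⟩ := clear φ.denom
  obtain ⟨A, B, hAB⟩ := φ.isCoprime_num_denom
  obtain ⟨k₃, A₁, hk₃, hA₁⟩ := clear A
  obtain ⟨k₄, B₁, hk₄, hB₁⟩ := clear B
  obtain ⟨f, hfF⟩ : ∃ f : o[X],
      f.map (algebraMap o F) = C (algebraMap o F (k₁ * k₂)) * φ.num :=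
    ⟨C k₂ * f₁, by rw [Polynomial.map_mul, hf₁, map_C, map_mul, C_mul]; ring⟩
  obtain ⟨g, hgF⟩ : ∃ g : o[X],
      g.map (algebraMap o F) = C (algebraMap o F (k₁ * k₂)) * φ.denom :=
    ⟨C k₁ * g₁, by rw [Polynomial.map_mul, hg₁, map_C, map_mul, C_mul]; ring⟩
  have hk : algebraMap o F (k₁ * k₂) ≠ 0 :=
    (map_ne_zero_iff _ inj).mpr (mul_ne_zero hk₁ hk₂)
  have hbez : C k₄ * A₁ * f + C k₃ * B₁ * g = C (k₁ * k₂ * k₃ * k₄) := by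
    apply map_injective _ inj
    simp only [Polynomial.map_add, Polynomial.map_mul, map_C, hfF, hgF, hA₁, hB₁, map_mul]
    linear_combination (C (algebraMap o F k₁) * C (algebraMap o F k₂) * C (algebraMap o F k₃) *
      C (algebraMap o F k₄)) * hAB
  have hdf : f.natDegree = φ.num.natDegree := by
    rw [← natDegree_map_eq_of_injective inj, hfF, natDegree_C_mul hk]
  have hdg : g.natDegree = φ.denom.natDegree := by
    rw [← natDegree_map_eq_of_injective inj, hgF, natDegree_C_mul hk]
  have hg0 : g ≠ 0 := fun h0 => by
    rw [h0, Polynomial.map_zero] at hgF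
    exact mul_ne_zero (C_ne_zero.mpr hk) φ.denom_ne_zero hgF.symm
  have hr : k₁ * k₂ * k₃ * k₄ ≠ 0 := mul_ne_zero (mul_ne_zero (mul_ne_zero hk₁ hk₂) hk₃) hk₄
  -- a nonzero coefficient of `f` or `g` in degree `deg φ`
  obtain ⟨s, hs0, hs⟩ : ∃ s : o, s ≠ 0 ∧
      (s = f.coeff (ratDegree φ) ∨ s = g.coeff (ratDegree φ)) := by
    rcases le_total φ.num.natDegree φ.denom.natDegree with h | h
    · exact ⟨g.leadingCoeff, leadingCoeff_ne_zero.mpr hg0,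
        .inr (by rw [ratDegree, max_eq_right h, ← hdg]; rfl)⟩
    · by_cases hf0 : f = 0
      · have : φ.num.natDegree = 0 := by rw [← hdf, hf0, natDegree_zero]
        exact ⟨g.leadingCoeff, leadingCoeff_ne_zero.mpr hg0,
          .inr (by rw [ratDegree, max_eq_right (by omega), ← hdg]; rfl)⟩
      · exact ⟨f.leadingCoeff, leadingCoeff_ne_zero.mpr hf0,
          .inl (by rw [ratDegree, max_eq_left h, ← hdf]; rfl)⟩
  refine (((finite_setOf_mem_asIdeal hr).union (finite_setOf_mem_asIdeal hs0)).union
    (finite_setOf_mem_asIdeal (leadingCoeff_ne_zero.mpr hg0))).subset fun 𝔭 hp => ?_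
  by_contra hcon
  simp only [Set.mem_union, Set.mem_ofPred_eq, not_or] at hcon
  obtain ⟨⟨h1, h2⟩, h3⟩ := hcon
  apply hp
  have res0 : ∀ x : o, x ∉ 𝔭.asIdeal → algebraMap o 𝔭.asIdeal.ResidueField x ≠ 0 := fun x hx => by
    simpa using hx
  refine ⟨_, f, g, _, hk, hfF, hgF, fun h0 => ?_, ?_, le_antisymm ?_ ?_, rfl⟩
  · have := congrArg (coeff · g.natDegree) h0
    simp only [coeff_map, coeff_zero] at this
    exact res0 _ h3 this
  · have hb := congrArg (Polynomial.map (algebraMap o 𝔭.asIdeal.ResidueField)) hbez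
    rw [Polynomial.map_add, Polynomial.map_mul, Polynomial.map_mul (q := g), map_C] at hb
    have hu : IsUnit (C (algebraMap o 𝔭.asIdeal.ResidueField (k₁ * k₂ * k₃ * k₄))) :=
      isUnit_C.mpr (res0 _ h1).isUnit
    obtain ⟨w, hw⟩ := hu.exists_left_inv
    refine ⟨w * (C k₄ * A₁).map (algebraMap o 𝔭.asIdeal.ResidueField),
      w * (C k₃ * B₁).map (algebraMap o 𝔭.asIdeal.ResidueField), ?_⟩
    rw [mul_assoc, mul_assoc, ← mul_add, hb, hw]
  · exact max_le_max (natDegree_map_le.trans hdf.le) (natDegree_map_le.trans hdg.le)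
  · rcases hs with rfl | rfl
    · exact le_max_of_le_left (le_natDegree_of_ne_zero (by rw [coeff_map]; exact res0 _ h2))
    · exact le_max_of_le_right (le_natDegree_of_ne_zero (by rw [coeff_map]; exact res0 _ h2))

end GoodReduction

/-! ### Estimates at one absolute value -/

section Estimates

variable {K : Type*} [Field K] (v : AbsoluteValue K ℝ)

theorem exists_abv_eval_le (h : K[X]) (R : ℝ) : ∃ B, 0 < B ∧ ∀ x, v x ≤ R → v (h.eval x) ≤ B := by
  induction h using Polynomial.induction_on' with
  | add f g hf hg =>
    obtain ⟨A, hA, hf⟩ := hf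
    obtain ⟨B, hB, hg⟩ := hg
    exact ⟨A + B, add_pos hA hB, fun x hx => by
      rw [eval_add]
      exact (v.add_le _ _).trans (add_le_add (hf x hx) (hg x hx))⟩
  | monomial n a =>
    refine ⟨v a * |R| ^ n + 1, by positivity, fun x hx => ?_⟩
    rw [eval_monomial, map_mul, map_pow]
    have : v x ≤ |R| := hx.trans (le_abs_self R)
    have := mul_le_mul_of_nonneg_left (pow_le_pow_left₀ (v.nonneg x) this n) (v.nonneg a)
    linarith

/-- Polynomials are Lipschitz at a point `y` on bounded sets. -/
theorem exists_abv_eval_sub_le (h : K[X]) (y : K) (R : ℝ) :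
    ∃ B, 0 < B ∧ ∀ x, v x ≤ R → v (h.eval x - h.eval y) ≤ B * v (x - y) := by
  obtain ⟨g, hg⟩ : X - C y ∣ h - C (h.eval y) := by
    rw [dvd_iff_isRoot]
    simp
  obtain ⟨B, hB, hB'⟩ := exists_abv_eval_le v g R
  refine ⟨B, hB, fun x hx => ?_⟩
  have := congrArg (eval x) hg
  simp only [eval_sub, eval_C, eval_mul, eval_X] at this
  rw [this, map_mul, mul_comm]
  exact mul_le_mul_of_nonneg_right (hB' x hx) (v.nonneg _)

/-- A rational function is continuous where its denominator does not vanish. -/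
theorem exists_abv_div_sub_lt (f g : K[X]) {y : K} (hy : g.eval y ≠ 0) {ε : ℝ} (hε : 0 < ε) :
    ∃ δ, 0 < δ ∧ ∀ x, v (x - y) < δ →
      v (f.eval x / g.eval x - f.eval y / g.eval y) < ε := by
  obtain ⟨A, hA, hf⟩ := exists_abv_eval_sub_le v f y (v y + 1)
  obtain ⟨B, hB, hg⟩ := exists_abv_eval_sub_le v g y (v y + 1)
  have hgy : 0 < v (g.eval y) := v.pos hy
  set M := A * v (g.eval y) + v (f.eval y) * B with hM
  have hM0 : 0 < M := by
    have := mul_pos hA hgy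
    have := mul_nonneg (v.nonneg (f.eval y)) hB.le
    linarith
  set G := v (g.eval y) with hG
  refine ⟨min 1 (min (G / (2 * B)) (ε * (G / 2 * G) / M)), by positivity, fun x hx => ?_⟩
  obtain ⟨h1, h2, h3⟩ : v (x - y) < 1 ∧ v (x - y) < G / (2 * B) ∧
    v (x - y) < ε * (G / 2 * G) / M := by simpa [lt_min_iff] using hx
  have hxR : v x ≤ v y + 1 := by
    have := v.add_le (x - y) y
    rw [sub_add_cancel] at this
    linarith
  have hfx := hf x hxR
  have hgx := hg x hxR
  have hgx2 : G / 2 < v (g.eval x) := by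
    have h4 : B * v (x - y) < G / 2 := by
      rw [lt_div_iff₀ (by positivity)] at h2
      linarith
    have := v.add_le (g.eval x) (g.eval y - g.eval x)
    rw [add_sub_cancel, v.map_sub] at this
    linarith
  have hgx0 : g.eval x ≠ 0 := fun h0 => by
    rw [h0, map_zero] at hgx2
    linarith
  have e : f.eval x / g.eval x - f.eval y / g.eval y =
      ((f.eval x - f.eval y) * g.eval y - f.eval y * (g.eval x - g.eval y)) /
        (g.eval x * g.eval y) := by
    field_simp
    ring
  rw [e, map_div₀, map_mul, ← hG, div_lt_iff₀ (mul_pos (v.pos hgx0) hgy)]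
  have hnum : v ((f.eval x - f.eval y) * g.eval y - f.eval y * (g.eval x - g.eval y)) ≤
      M * v (x - y) := by
    have := v.sub_le_add ((f.eval x - f.eval y) * g.eval y) (f.eval y * (g.eval x - g.eval y))
    rw [map_mul, map_mul] at this
    have t1 := mul_le_mul_of_nonneg_right hfx hgy.le
    have t2 := mul_le_mul_of_nonneg_left hgx (v.nonneg (f.eval y))
    rw [hM]
    linarith
  have h5 : M * v (x - y) < ε * (G / 2 * G) := by
    rw [lt_div_iff₀ hM0] at h3
    linarith
  have h6 : ε * (G / 2 * G) ≤ ε * (v (g.eval x) * G) := by gcongr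
  linarith

/-- Far out, a polynomial is at least as large as a multiple of its leading term. -/
theorem exists_abv_eval_ge {g : K[X]} (hg : g ≠ 0) :
    ∃ R δ : ℝ, 1 ≤ R ∧ 0 < δ ∧ ∀ x, R < v x → δ * v x ^ g.natDegree ≤ v (g.eval x) := by
  obtain ⟨B, hB, h⟩ := exists_abv_eval_sub_le v g.reverse 0 1
  have hl : 0 < v g.leadingCoeff := v.pos (leadingCoeff_ne_zero.mpr hg)
  refine ⟨max 1 (2 * B / v g.leadingCoeff), v g.leadingCoeff / 2, le_max_left _ _, by positivity,
    fun x hx => ?_⟩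
  obtain ⟨h1, h2⟩ := max_lt_iff.mp hx
  have hx0 : x ≠ 0 := fun h0 => by
    rw [h0, map_zero] at h1
    linarith
  have hvx : 0 < v x := v.pos hx0
  have hr := h x⁻¹ (by rw [map_inv₀]; exact inv_le_one_of_one_le₀ h1.le)
  rw [sub_zero, map_inv₀, ← coeff_zero_eq_eval_zero, coeff_zero_reverse] at hr
  have e : g.eval x = x ^ g.natDegree * g.reverse.eval x⁻¹ := by
    have : Invertible x := invertibleOfNonzero hx0
    have := eval₂_reverse_mul_pow (RingHom.id K) x g
    rw [invOf_eq_inv] at this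
    rw [mul_comm]
    exact this.symm
  rw [e, map_mul, map_pow, mul_comm]
  refine mul_le_mul_of_nonneg_left ?_ (by positivity)
  have h3 : B * (v x)⁻¹ ≤ v g.leadingCoeff / 2 := by
    rw [div_lt_iff₀ hl] at h2
    rw [← div_eq_mul_inv, div_le_iff₀ hvx]
    linarith
  have := v.add_le (g.reverse.eval x⁻¹) (g.leadingCoeff - g.reverse.eval x⁻¹)
  rw [add_sub_cancel, v.map_sub] at this
  linarith

/-- Let `f - c g = (x - a)ʲ h` with `f`, `g` coprime. Where `f / g` stays away from `c`, the
functions `1 / h` and `x / h` are bounded. -/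
theorem exists_abv_inv_eval_le {f g h : K[X]} {a c : K} {j : ℕ} (hfg : IsCoprime f g)
    (e : f - C c * g = (X - C a) ^ j * h) (hh : 1 ≤ h.natDegree) {ε : ℝ} (hε : 0 < ε) :
    ∃ B, ∀ x, h.eval x ≠ 0 → g.eval x ≠ 0 → ε ≤ v (f.eval x / g.eval x - c) →
      v (h.eval x)⁻¹ ≤ B ∧ v (x / h.eval x) ≤ B := by
  have hh0 : h ≠ 0 := by rintro rfl; simp at hh
  obtain ⟨R, δ, hR, hδ, hbig⟩ := exists_abv_eval_ge v hh0
  obtain ⟨s, t, hst⟩ : IsCoprime (f - C c * g) g := by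
    obtain ⟨s, t, hst⟩ := hfg
    exact ⟨s, t + C c * s, by linear_combination hst⟩
  obtain ⟨S, hS, hs⟩ := exists_abv_eval_le v s R
  obtain ⟨T, hT, ht⟩ := exists_abv_eval_le v t R
  set Q := (R + v a) ^ j with hQ
  have hQ0 : 0 < Q := pow_pos (by linarith [v.nonneg a]) j
  -- lower bound for `h x` on the disc of radius `R`
  set η := Q * (S + T / ε) with hη
  have hη0 : 0 < η := by positivity
  refine ⟨max (max δ⁻¹ η) (R * η), fun x hx hgx hfar => ?_⟩
  rcases lt_or_ge R (v x) with hxR | hxR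
  · have hvx : 1 ≤ v x := hR.trans hxR.le
    have hb := hbig x hxR
    have hb1 : δ * v x ≤ v (h.eval x) := by
      refine le_trans (mul_le_mul_of_nonneg_left ?_ hδ.le) hb
      exact le_self_pow₀ hvx (by omega)
    have h1 : v (x / h.eval x) ≤ δ⁻¹ := by
      rw [map_div₀, div_le_iff₀ (v.pos hx), inv_mul_eq_div, le_div_iff₀ hδ]
      linarith
    refine ⟨le_trans ?_ (le_trans h1 ?_), h1.trans ?_⟩
    · rw [map_div₀, map_inv₀, inv_eq_one_div]
      gcongr
    · exact (le_max_left _ _).trans (le_max_left _ _)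
    · exact (le_max_left _ _).trans (le_max_left _ _)
  · have hst' := congrArg (eval x) hst
    rw [e] at hst'
    simp only [eval_add, eval_mul, eval_pow, eval_sub, eval_X, eval_C, eval_one] at hst'
    have he := congrArg (eval x) e
    simp only [eval_mul, eval_pow, eval_sub, eval_X, eval_C] at he
    set P := (x - a) ^ j * h.eval x with hP
    have hgP : v (g.eval x) ≤ v P / ε := by
      rw [le_div_iff₀ hε, ← he]
      have e3 : f.eval x - c * g.eval x = g.eval x * (f.eval x / g.eval x - c) := by
        field_simp
      rw [e3, map_mul]
      exact mul_le_mul_of_nonneg_left hfar (v.nonneg _)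
    have h1 : 1 ≤ (S + T / ε) * v P := by
      have h2 := v.add_le (s.eval x * P) (t.eval x * g.eval x)
      rw [hst', map_one, map_mul v (s.eval x) P, map_mul v (t.eval x)] at h2
      have h3 := mul_le_mul_of_nonneg_right (hs x hxR) (v.nonneg P)
      have h4 : v (t.eval x) * v (g.eval x) ≤ T * (v P / ε) :=
        mul_le_mul (ht x hxR) hgP (v.nonneg _) hT.le
      have h5 : T * (v P / ε) = T / ε * v P := by ring
      rw [add_mul]
      linarith
    have hPQ : v P ≤ Q * v (h.eval x) := by
      rw [hP, map_mul, map_pow]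
      refine mul_le_mul_of_nonneg_right (pow_le_pow_left₀ (v.nonneg _) ?_ j) (v.nonneg _)
      have := v.sub_le_add x a
      linarith
    have h2 : (v (h.eval x))⁻¹ ≤ η := by
      rw [inv_eq_one_div, div_le_iff₀ (v.pos hx)]
      have := mul_le_mul_of_nonneg_left hPQ (by positivity : 0 ≤ S + T / ε)
      rw [hη]
      linarith
    rw [map_inv₀, map_div₀, div_eq_mul_inv]
    refine ⟨h2.trans ((le_max_right _ _).trans (le_max_left _ _)), le_trans ?_ (le_max_right _ _)⟩
    exact mul_le_mul hxR h2 (inv_nonneg.mpr (v.nonneg _)) (by linarith)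

end Estimates

/-! ### Estimates at a prime of good reduction -/

section Valuation

variable {F Γ₀ : Type*} [Field F] [LinearOrderedCommGroupWithZero Γ₀] (w : Valuation F Γ₀)

theorem valuation_eval_le_one {h : F[X]} (hh : ∀ i, w (h.coeff i) ≤ 1) {x : F} (hx : w x ≤ 1) :
    w (h.eval x) ≤ 1 := by
  rw [eval_eq_sum_range]
  refine w.map_sum_le fun i _ => ?_
  rw [map_mul, map_pow]
  exact mul_le_one' (hh i) (pow_le_one' hx i)

theorem valuation_eval_sub_le {h : F[X]} (hh : ∀ i, w (h.coeff i) ≤ 1) {x y : F} (hx : w x ≤ 1)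
    (hy : w y ≤ 1) : w (h.eval x - h.eval y) ≤ w (x - y) := by
  obtain ⟨h', rfl⟩ : ∃ h' : w.integer[X], h'.map w.integer.subtype = h :=
    (mem_lifts h).mp ((lifts_iff_coeff_lifts h).mpr fun i => ⟨⟨_, hh i⟩, rfl⟩)
  obtain ⟨k, hk⟩ := sub_dvd_eval_sub (⟨x, hx⟩ : w.integer) ⟨y, hy⟩ h'
  have := congrArg w.integer.subtype hk
  rw [map_sub, map_mul, map_sub, ← eval_map_apply, ← eval_map_apply] at this
  change _ = (x - y) * (k : F) at this
  change w (eval (w.integer.subtype ⟨x, hx⟩) _ - eval (w.integer.subtype ⟨y, hy⟩) _) ≤ _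
  rw [this, map_mul]
  exact mul_le_of_le_one_right' k.2

theorem valuation_eval_of_one_lt {h : F[X]} (hh : ∀ i, w (h.coeff i) ≤ 1)
    (hl : w h.leadingCoeff = 1) {x : F} (hx : 1 < w x) : w (h.eval x) = w x ^ h.natDegree := by
  have hx0 : x ≠ 0 := by rintro rfl; simp at hx
  have hinv : w x⁻¹ < 1 := by
    rw [map_inv₀]
    exact inv_lt_one_of_one_lt₀ hx
  have hr := valuation_eval_sub_le w (h := h.reverse) (x := x⁻¹) (y := 0)
    (fun i => by rw [coeff_reverse]; exact hh _) hinv.le (by simp)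
  rw [sub_zero, ← coeff_zero_eq_eval_zero, coeff_zero_reverse] at hr
  have hr1 : w (h.reverse.eval x⁻¹) = 1 := by
    rw [← hl]
    exact (w.map_eq_of_sub_lt ((hr.trans_lt hinv).trans_eq hl.symm))
  have e : h.eval x = x ^ h.natDegree * h.reverse.eval x⁻¹ := by
    have : Invertible x := invertibleOfNonzero hx0
    have := eval₂_reverse_mul_pow (RingHom.id F) x h
    rw [invOf_eq_inv] at this
    rw [mul_comm]
    exact this.symm
  rw [e, map_mul, map_pow, hr1, mul_one]

/-- Let `f - c g = (x - a)ʲ h` with everything integral, `f - c g` and `g` coprime over the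
valuation ring, and `h` of unit leading coefficient with `h(a)` a unit. If `x` is congruent to `a`
whenever `f(x) / g(x)` is congruent to `c`, then `1 / h(x)` and `x / h(x)` are integral. -/
theorem valuation_inv_eval_le_one {f g h s t : F[X]} {a c : F} {j : ℕ}
    (hst : s * (f - C c * g) + t * g = 1) (e : f - C c * g = (X - C a) ^ j * h)
    (hs : ∀ i, w (s.coeff i) ≤ 1) (ht : ∀ i, w (t.coeff i) ≤ 1) (hh : ∀ i, w (h.coeff i) ≤ 1)
    (hl : w h.leadingCoeff = 1) (hdeg : 1 ≤ h.natDegree) (ha : w a ≤ 1) (hha : w (h.eval a) = 1)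
    {x : F} (hgx : g.eval x ≠ 0)
    (hx : w x ≤ 1 → w (f.eval x / g.eval x - c) < 1 → w (x - a) < 1) :
    w (h.eval x)⁻¹ ≤ 1 ∧ w (x / h.eval x) ≤ 1 := by
  rcases lt_or_ge 1 (w x) with h1 | h1
  · have hv := valuation_eval_of_one_lt w hh hl h1
    have hle : w x ≤ w x ^ h.natDegree := le_self_pow₀ h1.le (by omega)
    have hpos : 0 < w x ^ h.natDegree := lt_of_lt_of_le (zero_lt_one.trans h1) hle
    rw [map_inv₀, map_div₀, hv]
    exact ⟨inv_le_one_of_one_le₀ (h1.le.trans hle), (div_le_one₀ hpos).mpr hle⟩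
  · have hle := valuation_eval_le_one w hh h1
    have hunit : w (h.eval x) = 1 := by
      by_contra hne
      have hlt : w (h.eval x) < 1 := lt_of_le_of_ne hle hne
      have hxa : w (x - a) ≤ 1 := w.map_sub_le h1 ha
      have hP : w ((x - a) ^ j * h.eval x) < 1 := by
        rw [map_mul, map_pow]
        exact mul_lt_one_of_nonneg_of_lt_one_right (pow_le_one' hxa j) zero_le hlt
      have hst' := congrArg (eval x) hst
      have he := congrArg (eval x) e
      simp only [eval_add, eval_mul, eval_one] at hst'
      rw [he] at hst'
      simp only [eval_sub, eval_mul, eval_pow, eval_X, eval_C] at he hst'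
      -- the denominator is a unit at `x` because it is coprime to the numerator of `f / g - c`
      have htg : w (t.eval x * g.eval x) = 1 := by
        have : t.eval x * g.eval x = 1 - s.eval x * ((x - a) ^ j * h.eval x) := by
          rw [← hst']; ring
        rw [this]
        refine w.map_one_sub_of_lt ?_
        rw [map_mul]
        exact mul_lt_one_of_nonneg_of_lt_one_right (valuation_eval_le_one w hs h1) zero_le hP
      have hg1 : 1 ≤ w (g.eval x) := by
        rw [map_mul] at htg
        rw [← htg]
        exact mul_le_of_le_one_left' (valuation_eval_le_one w ht h1)
      have hfar : w (f.eval x / g.eval x - c) < 1 := by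
        have : f.eval x / g.eval x - c = (x - a) ^ j * h.eval x / g.eval x := by
          rw [← he]; field_simp
        rw [this, map_div₀]
        exact (div_lt_one₀ (zero_lt_one.trans_le hg1)).mpr (hP.trans_le hg1)
      have hxa1 := (valuation_eval_sub_le w hh h1 ha).trans_lt (hx h1 hfar)
      exact hne ((w.map_eq_of_sub_lt (hxa1.trans_eq hha.symm)).trans hha)
    rw [map_inv₀, map_div₀, hunit]
    simpa using h1

end Valuation

section Reduction

variable {o F : Type*} [CommRing o] [Field F] [Algebra o F] [IsDedekindDomain o]
  [IsFractionRing o F]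

theorem reduce_coe_eq_reduce_coe_iff (𝔭 : HeightOneSpectrum o) {x y : F}
    (hx : 𝔭.valuation F x ≤ 1) (hy : 𝔭.valuation F y ≤ 1) :
    reduce 𝔭 (x : OnePoint F) = reduce 𝔭 (y : OnePoint F) ↔ 𝔭.valuation F (x - y) < 1 := by
  obtain ⟨b, d, hb⟩ := 𝔭.exists_primeCompl_mul_eq_of_integer x hx
  obtain ⟨b', d', hb'⟩ := 𝔭.exists_primeCompl_mul_eq_of_integer y hy
  have hd : 𝔭.valuation F (algebraMap o F d) = 1 := (𝔭.valuation_eq_one_iff_notMem).mpr d.2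
  have hd' : 𝔭.valuation F (algebraMap o F d') = 1 := (𝔭.valuation_eq_one_iff_notMem).mpr d'.2
  have e : algebraMap o F (b * d' - b' * d) = (x - y) * (algebraMap o F d * algebraMap o F d') := by
    rw [map_sub, map_mul, map_mul, ← hb, ← hb']
    ring
  have e2 : 𝔭.valuation F (x - y) = 𝔭.valuation F (algebraMap o F (b * d' - b' * d)) := by
    rw [e, map_mul, map_mul, hd, hd', mul_one, mul_one]
  have hdr : algebraMap o 𝔭.asIdeal.ResidueField d ≠ 0 := by
    simpa using (Ideal.mem_primeCompl_iff.mp d.2)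
  have hdr' : algebraMap o 𝔭.asIdeal.ResidueField d' ≠ 0 := by
    simpa using (Ideal.mem_primeCompl_iff.mp d'.2)
  rw [reduce_coe_of_eq 𝔭 x b d d.2 hb, reduce_coe_of_eq 𝔭 y b' d' d'.2 hb', OnePoint.coe_eq_coe,
    div_eq_div_iff hdr hdr', ← map_mul, ← map_mul, ← sub_eq_zero, ← map_sub,
    Ideal.algebraMap_residueField_eq_zero, e2, 𝔭.valuation_lt_one_iff_mem]

end Reduction

/-! ### Orbits and periodic reduction -/

section Orbits

/-- Points with denominators supported on a finite set `S` of primes and bounded at a suitable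
finite set of absolute values (in practice those above `∞` and those of `S`) are finite in number.
This is the only arithmetic input from the global field `F` besides the infinitude of primes. -/
def HasFiniteBoundedSets (o F : Type*) [CommRing o] [IsDedekindDomain o] [Field F] [Algebra o F]
    [IsFractionRing o F] : Prop :=
  ∀ S : Set (HeightOneSpectrum o), S.Finite → ∃ V : Finset (AbsoluteValue F ℝ), ∀ B : ℝ,
    {t : F | (∀ 𝔭 ∉ S, 𝔭.valuation F t ≤ 1) ∧ ∀ v ∈ V, v t ≤ B}.Finite

section FarPoints

variable {F : Type*} [Field F] {f g : F[X]} {x : ℕ → F}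

theorem exists_abv_orbit_sub_lt (v : AbsoluteValue F ℝ) (hg : ∀ m, g.eval (x m) ≠ 0)
    (hx : ∀ m, x (m + 1) = f.eval (x m) / g.eval (x m)) (n k : ℕ) {ε : ℝ} (hε : 0 < ε) :
    ∃ δ, 0 < δ ∧ ∀ m, v (x m - x n) < δ → v (x (m + k) - x (n + k)) < ε := by
  induction k generalizing ε with
  | zero => exact ⟨ε, hε, fun m h => h⟩
  | succ k ih =>
    obtain ⟨η, hη, h⟩ := exists_abv_div_sub_lt v f g (hg (n + k)) hε
    obtain ⟨δ, hδ, h'⟩ := ih hη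
    refine ⟨δ, hδ, fun m hm => ?_⟩
    rw [← add_assoc, ← add_assoc, hx, hx]
    exact h _ (h' m hm)

/-- An infinite orbit which is `v`-adically close to its point `x n` at time `m` is not close to
`x n` again at time `m + k`: it is then close to `x (n + k) ≠ x n`. -/
theorem exists_abv_orbit_not_close_twice (v : AbsoluteValue F ℝ) (hinj : Function.Injective x)
    (hg : ∀ m, g.eval (x m) ≠ 0) (hx : ∀ m, x (m + 1) = f.eval (x m) / g.eval (x m)) (n : ℕ)
    {k : ℕ} (hk : 1 ≤ k) :
    ∃ ε, 0 < ε ∧ ∀ m, v (x m - x n) < ε → ε ≤ v (x (m + k) - x n) := by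
  have hd : 0 < v (x (n + k) - x n) := v.pos (sub_ne_zero.mpr (hinj.ne (by omega)))
  obtain ⟨δ, hδ, h⟩ := exists_abv_orbit_sub_lt v hg hx n k (half_pos hd)
  refine ⟨min δ (v (x (n + k) - x n) / 2), lt_min hδ (half_pos hd), fun m hm => ?_⟩
  have h1 := h m (hm.trans_le (min_le_left _ _))
  have h2 := v.add_le (x (n + k) - x (m + k)) (x (m + k) - x n)
  rw [sub_add_sub_cancel, v.map_sub (x (n + k)) (x (m + k))] at h2
  refine (min_le_right _ _).trans ?_
  linarith

/-- In an infinite orbit there are infinitely many points away from `x n` at all absolute values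
of a finite set `V` at once: among `|V| + 1` consecutive times, two at which the orbit is close to
`x n` would share the absolute value by the pigeonhole principle. -/
theorem exists_forall_le_abv_orbit_sub (V : Finset (AbsoluteValue F ℝ))
    (hinj : Function.Injective x) (hg : ∀ m, g.eval (x m) ≠ 0)
    (hx : ∀ m, x (m + 1) = f.eval (x m) / g.eval (x m)) (n : ℕ) :
    ∃ ε, 0 < ε ∧ ∀ M, ∃ m, M ≤ m ∧ ∀ v ∈ V, ε ≤ v (x m - x n) := by
  obtain ⟨ε, hε, h⟩ : ∃ ε : ℝ, 0 < ε ∧ ∀ v ∈ V, ∀ k ∈ Finset.Icc 1 V.card,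
      ∀ m, v (x m - x n) < ε → ε ≤ v (x (m + k) - x n) := by
    have : ∀ᶠ ε : ℝ in nhdsWithin 0 (Set.Ioi 0), ∀ v ∈ V, ∀ k ∈ Finset.Icc 1 V.card,
        ∀ m, v (x m - x n) < ε → ε ≤ v (x (m + k) - x n) := by
      refine (Filter.eventually_all_finset V).mpr fun v _ =>
        (Filter.eventually_all_finset _).mpr fun k hk => ?_
      obtain ⟨ε, hε, h⟩ := exists_abv_orbit_not_close_twice v hinj hg hx n (Finset.mem_Icc.mp hk).1
      filter_upwards [Ioo_mem_nhdsGT hε] with η hη m hm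
      exact hη.2.le.trans (h m (hm.trans hη.2))
    obtain ⟨ε, h, hε⟩ := (this.and self_mem_nhdsWithin).exists
    exact ⟨ε, hε, h⟩
  refine ⟨ε, hε, fun M => ?_⟩
  by_contra! hcon
  choose u hu hu' using fun i : ℕ => hcon (M + i) (Nat.le_add_right M i)
  obtain ⟨i, hi, j, hj, hij, e⟩ := Finset.exists_ne_map_eq_of_card_lt_of_maps_to
    (s := Finset.range (V.card + 1)) (t := V) (by simp) (f := u) (fun i _ => hu i)
  wlog hlt : i < j generalizing i j
  · exact this j hj i hi hij.symm e.symm (by omega)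
  have hj' := Finset.mem_range.mp hj
  have h1 := h _ (hu i) (j - i) (Finset.mem_Icc.mpr (by omega)) _ (hu' i)
  rw [show M + i + (j - i) = M + j by omega, e] at h1
  exact absurd (hu' j) (not_lt.mpr h1)

end FarPoints

variable {o F : Type*} [CommRing o] [Field F] [Algebra o F] [IsDedekindDomain o]
  [IsFractionRing o F]

/-- An infinite orbit `x 0, x 1, …` of `f / g` in `F` cannot have the property that at almost all
primes a congruence `x (m + 1) ≡ x 1` implies `x m ≡ x 0`, provided the fibre through `x 0` has
another point (a root of `h`). -/
theorem false_of_orbit (hN : HasFiniteBoundedSets o F) {f g h : F[X]} {x : ℕ → F}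
    (hinj : Function.Injective x) (hfg : IsCoprime f g) (hg : ∀ m, g.eval (x m) ≠ 0)
    (hx : ∀ m, x (m + 1) = f.eval (x m) / g.eval (x m)) {j : ℕ}
    (e : f - C (x 1) * g = (X - C (x 0)) ^ j * h) (hh : 1 ≤ h.natDegree) (hh0 : h.eval (x 0) ≠ 0)
    {S : Set (HeightOneSpectrum o)} (hS : S.Finite)
    (hper : ∀ 𝔭 ∉ S, ∀ m, 𝔭.valuation F (x m) ≤ 1 →
      𝔭.valuation F (x (m + 1) - x 1) < 1 → 𝔭.valuation F (x m - x 0) < 1) : False := by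
  obtain ⟨s, t, hst⟩ : IsCoprime (f - C (x 1) * g) g := by
    obtain ⟨s, t, hst⟩ := hfg
    exact ⟨s, t + C (x 1) * s, by linear_combination hst⟩
  have hcoeff : ∀ r : F[X],
      {𝔭 : HeightOneSpectrum o | ¬ ∀ i, 𝔭.valuation F (r.coeff i) ≤ 1}.Finite := fun r => by
    refine (Set.Finite.biUnion r.support.finite_toSet
      fun i _ => finite_setOf_one_lt_valuation (o := o) (r.coeff i)).subset fun 𝔭 hp => ?_
    obtain ⟨i, hi⟩ := not_forall.mp hp
    refine Set.mem_biUnion (x := i) ?_ hi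
    rw [Finset.mem_coe, mem_support_iff]
    intro h0
    rw [h0, map_zero] at hi
    exact hi zero_le
  have hne : h ≠ 0 := by rintro rfl; simp at hh
  set S' : Set (HeightOneSpectrum o) := S ∪ {𝔭 | ¬ ∀ i, 𝔭.valuation F (s.coeff i) ≤ 1} ∪
    {𝔭 | ¬ ∀ i, 𝔭.valuation F (t.coeff i) ≤ 1} ∪ {𝔭 | ¬ ∀ i, 𝔭.valuation F (h.coeff i) ≤ 1} ∪
    {𝔭 | 𝔭.valuation F h.leadingCoeff ≠ 1} ∪ {𝔭 | ¬ 𝔭.valuation F (x 0) ≤ 1} ∪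
    {𝔭 | 𝔭.valuation F (h.eval (x 0)) ≠ 1} with hS'
  have hS'f : S'.Finite := (((((hS.union (hcoeff s)).union (hcoeff t)).union (hcoeff h)).union
    (finite_setOf_valuation_ne_one (leadingCoeff_ne_zero.mpr hne))).union
    (finite_setOf_one_lt_valuation _)).union (finite_setOf_valuation_ne_one hh0)
  obtain ⟨V, hV⟩ := hN S' hS'f
  obtain ⟨ε, hε, hfar⟩ := exists_forall_le_abv_orbit_sub V hinj hg hx 1
  choose B hB using fun v => exists_abv_inv_eval_le v hfg e hh hε
  have hfin := hV (∑ v ∈ V, |B v|)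
  set T := {t : F | (∀ 𝔭 ∉ S', 𝔭.valuation F t ≤ 1) ∧ ∀ v ∈ V, v t ≤ ∑ v ∈ V, |B v|} with hT
  have hle : ∀ v ∈ V, B v ≤ ∑ v ∈ V, |B v| := fun v hv =>
    (le_abs_self _).trans (Finset.single_le_sum (f := fun v => |B v|)
      (fun _ _ => abs_nonneg _) hv)
  have hhx : ∀ m, 1 ≤ m → h.eval (x m) ≠ 0 := fun m hm h0 => by
    have he := congrArg (eval (x m)) e
    simp only [eval_sub, eval_mul, eval_C, h0, mul_zero, sub_eq_zero] at he
    have : x (m + 1) = x 1 := by rw [hx, he, mul_div_cancel_right₀ _ (hg m)]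
    have := hinj this
    omega
  have hmem : ∀ m, 1 ≤ m → (∀ v ∈ V, ε ≤ v (x (m + 1) - x 1)) →
      (h.eval (x m))⁻¹ ∈ T ∧ x m / h.eval (x m) ∈ T := fun m hm hf => by
    have hp : ∀ 𝔭 ∉ S', 𝔭.valuation F (h.eval (x m))⁻¹ ≤ 1 ∧
        𝔭.valuation F (x m / h.eval (x m)) ≤ 1 := fun 𝔭 hp => by
      simp only [hS', Set.mem_union, Set.mem_ofPred_eq, not_or, not_not] at hp
      obtain ⟨⟨⟨⟨⟨⟨p0, p1⟩, p2⟩, p3⟩, p4⟩, p5⟩, p6⟩ := hp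
      exact valuation_inv_eval_le_one _ hst e p1 p2 p3 p4 hh p5 p6 (hg m)
        fun h1 h2 => hper 𝔭 p0 m h1 (by rwa [hx m])
    have hv : ∀ v ∈ V, v (h.eval (x m))⁻¹ ≤ B v ∧ v (x m / h.eval (x m)) ≤ B v := fun v hv =>
      hB v (x m) (hhx m hm) (hg m) (by rw [← hx]; exact hf v hv)
    exact ⟨⟨fun 𝔭 h => (hp 𝔭 h).1, fun v h => (hv v h).1.trans (hle v h)⟩,
      ⟨fun 𝔭 h => (hp 𝔭 h).2, fun v h => (hv v h).2.trans (hle v h)⟩⟩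
  have hfin2 : (x ⁻¹' (Set.image2 (fun s t => t / s) T T)).Finite :=
    (hfin.image2 _ hfin).preimage hinj.injOn
  obtain ⟨N, hN'⟩ := hfin2.bddAbove
  obtain ⟨m, hm, hm'⟩ := hfar (N + 3)
  obtain ⟨k, rfl⟩ : ∃ k, m = k + 1 := ⟨m - 1, by omega⟩
  obtain ⟨h1, h2⟩ := hmem k (by omega) hm'
  have hk : k ≤ N := hN' ⟨_, h1, _, h2, by
    have := hhx k (by omega)
    simp only
    field_simp⟩
  omega

theorem HasPeriodicReduction.exists_reduce_iterate_eq {φ : RatFunc F} {α : F}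
    {𝔭 : HeightOneSpectrum o} (h : HasPeriodicReduction φ α 𝔭) :
    ∃ n, 1 ≤ n ∧ reduce 𝔭 ((ratMap φ)^[n] (α : OnePoint F)) = reduce 𝔭 (α : OnePoint F) := by
  rcases h with ⟨ψ, hψ, n, hn, e⟩ | ⟨-, n, hn, e⟩
  · exact ⟨n, hn, by rw [hψ.reduce_iterate, e]⟩
  · exact ⟨n, hn, by simpa using e 0⟩

/-- The reduced map is injective on periodic points, in particular on the reduction of the orbit
of a point with periodic reduction. -/
theorem HasPeriodicReduction.reduce_iterate_injective {φ : RatFunc F} {α : F}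
    {𝔭 : HeightOneSpectrum o} (h : HasPeriodicReduction φ α 𝔭)
    (hgood : ∃ ψ, HasGoodReductionTo φ 𝔭 ψ) {k l : ℕ}
    (e : reduce 𝔭 ((ratMap φ)^[k + 1] (α : OnePoint F)) =
      reduce 𝔭 ((ratMap φ)^[l + 1] (α : OnePoint F))) :
    reduce 𝔭 ((ratMap φ)^[k] (α : OnePoint F)) = reduce 𝔭 ((ratMap φ)^[l] (α : OnePoint F)) := by
  rcases h with ⟨ψ, hψ, n, hn, hper⟩ | ⟨hbad, -⟩
  · rw [hψ.reduce_iterate, hψ.reduce_iterate] at e ⊢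
    obtain ⟨n, rfl⟩ : ∃ n', n = n' + 1 := ⟨n - 1, by omega⟩
    have key : ∀ k, (ratMap ψ)^[k] (reduce 𝔭 (α : OnePoint F)) =
        (ratMap ψ)^[n] ((ratMap ψ)^[k + 1] (reduce 𝔭 (α : OnePoint F))) := fun k => by
      rw [← Function.iterate_add_apply, show n + (k + 1) = k + (n + 1) by omega,
        Function.iterate_add_apply, hper]
    rw [key, e, ← key]
  · exact absurd hgood hbad

theorem ratMap_coe_eq_coe_iff {K : Type*} [Field K] {φ : RatFunc K} {a b : K} :
    ratMap φ (a : OnePoint K) = (b : OnePoint K) ↔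
      φ.denom.eval a ≠ 0 ∧ b = φ.num.eval a / φ.denom.eval a := by
  classical
  by_cases h : φ.denom.eval a = 0
  · rw [show ratMap φ (a : OnePoint K) = ∞ from if_pos h]
    simp [h]
  · rw [show ratMap φ (a : OnePoint K) = ((φ.num.eval a / φ.denom.eval a : K) : OnePoint K) from
      if_neg h, OnePoint.coe_eq_coe]
    simp [h, eq_comm]

theorem coeff_num_sub_ne_zero {K : Type*} [Field K] {φ : RatFunc K} {c : K}
    (h : ratMap φ ∞ ≠ (c : OnePoint K)) :
    (φ.num - C c * φ.denom).coeff (ratDegree φ) ≠ 0 := by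
  classical
  rw [coeff_sub, coeff_C_mul]
  by_cases hd : φ.denom.coeff (ratDegree φ) = 0
  · rw [hd, mul_zero, sub_zero]
    rcases max_choice φ.num.natDegree φ.denom.natDegree with e | e
    · intro h0
      rw [ratDegree, e] at h0 hd
      have hn : φ.num = 0 := leadingCoeff_eq_zero.mp h0
      rw [hn, natDegree_zero] at hd e
      exact φ.denom_ne_zero (by
        rw [Polynomial.eq_C_of_natDegree_eq_zero (by omega : φ.denom.natDegree = 0), hd, C_0])
    · rw [ratDegree, e] at hd
      exact absurd (leadingCoeff_eq_zero.mp hd) φ.denom_ne_zero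
  · intro h0
    apply h
    rw [show ratMap φ ∞ = ((φ.num.coeff (ratDegree φ) / φ.denom.coeff (ratDegree φ) : K) :
      OnePoint K) from if_neg hd, OnePoint.coe_eq_coe, div_eq_iff hd]
    exact sub_eq_zero.mp h0

/-- Unless `a` is totally ramified over its image `c`, the fibre through `a` contains another point:
a root of `h`. -/
theorem exists_eq_pow_mul_of_not_isTotallyRamifiedAt {K : Type*} [Field K] {φ : RatFunc K} {a c : K}
    (hinf : ratMap φ ∞ ≠ (c : OnePoint K)) (hram : ¬ IsTotallyRamifiedAt φ a c) :
    ∃ (j : ℕ) (h : K[X]), φ.num - C c * φ.denom = (X - C a) ^ j * h ∧ 1 ≤ h.natDegree ∧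
      h.eval a ≠ 0 := by
  have hc := coeff_num_sub_ne_zero hinf
  have hne : φ.num - C c * φ.denom ≠ 0 := fun h0 => hc (by rw [h0, coeff_zero])
  have hdeg : (φ.num - C c * φ.denom).natDegree = ratDegree φ := by
    refine le_antisymm ((natDegree_sub_le _ _).trans (max_le_max le_rfl (natDegree_C_mul_le _ _)))
      (le_natDegree_of_ne_zero hc)
  obtain ⟨j, h, e, hh⟩ : ∃ (j : ℕ) (h : K[X]),
      φ.num - C c * φ.denom = (X - C a) ^ j * h ∧ ¬ (X - C a) ∣ h :=
    ⟨_, exists_eq_pow_rootMultiplicity_mul_and_not_dvd _ hne a⟩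
  refine ⟨j, h, e, ?_, fun h0 => hh (dvd_iff_isRoot.mpr h0)⟩
  by_contra hlt
  have h0 : h.natDegree = 0 := by omega
  obtain ⟨u, rfl⟩ := natDegree_eq_zero.mp h0
  have hu : u ≠ 0 := by rintro rfl; simp at hh
  apply hram
  refine ⟨u, hu, ?_⟩
  have hd2 := hdeg
  rw [e, natDegree_mul_C hu, natDegree_pow, natDegree_X_sub_C, mul_one] at hd2
  rw [← hd2, e, mul_comm]

/-- The infinitude statement for any Dedekind domain with infinitely many primes whose fraction
field has finite bounded sets. -/
theorem infinite_setOf_not_hasPeriodicReduction [Infinite (HeightOneSpectrum o)]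
    (hN : HasFiniteBoundedSets o F) {φ : RatFunc F}
    (hφ : (CharZero F ∧ 2 ≤ ratDegree φ) ∨ 2 ≤ ratSepDegree φ) {α : F}
    (hα : ¬ IsPeriodicPoint φ (α : OnePoint F)) :
    {𝔭 : HeightOneSpectrum o | ¬ HasPeriodicReduction φ α 𝔭}.Infinite := by
  intro hfin
  set P : ℕ → OnePoint F := fun n => (ratMap φ)^[n] (α : OnePoint F) with hP
  have hPs : ∀ n, P (n + 1) = ratMap φ (P n) := fun n => Function.iterate_succ_apply' _ _ _
  by_cases hinj : Function.Injective P
  · -- from time `M` on, the orbit avoids `∞` and `φ(∞)`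
    obtain ⟨M, hM⟩ : ∃ M, ∀ m, M ≤ m → P m ≠ ∞ ∧ P m ≠ ratMap φ ∞ := by
      have : (P ⁻¹' {∞, ratMap φ ∞}).Finite := (Set.toFinite _).preimage hinj.injOn
      obtain ⟨N, hN'⟩ := this.bddAbove
      refine ⟨N + 1, fun m hm => ?_⟩
      have hm' : m ∉ P ⁻¹' {∞, ratMap φ ∞} := fun h => by
        have := hN' h
        omega
      simpa using hm'
    have hx : ∀ m, ∃ y : F, P (M + m) = y := fun m =>
      (OnePoint.ne_infty_iff_exists.mp (hM (M + m) (Nat.le_add_right _ _)).1).imp fun _ h => h.symm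
    choose x hx using hx
    have hxinj : Function.Injective x := fun a b h => by
      have : P (M + a) = P (M + b) := by rw [hx, hx, h]
      have := hinj this
      omega
    have hstep : ∀ m, φ.denom.eval (x m) ≠ 0 ∧
        x (m + 1) = φ.num.eval (x m) / φ.denom.eval (x m) := fun m => by
      rw [← ratMap_coe_eq_coe_iff, ← hx, ← hx, ← add_assoc, hPs]
    have hinf : ∀ m, ratMap φ ∞ ≠ (x m : OnePoint F) := fun m => by
      rw [← hx]
      exact (hM _ (Nat.le_add_right _ _)).2.symm
    have hd : ratDegree φ ≠ 0 := fun h0 => by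
      have h1 := coeff_num_sub_ne_zero (hinf 1)
      have hd1 : (φ.num - C (x 1) * φ.denom).natDegree = 0 := by
        refine Nat.le_zero.mp (h0 ▸ ?_)
        exact (natDegree_sub_le _ _).trans (max_le_max le_rfl (natDegree_C_mul_le _ _))
      have he : (φ.num - C (x 1) * φ.denom).eval (x 0) = 0 := by
        rw [eval_sub, eval_mul, eval_C, (hstep 0).2, div_mul_cancel₀ _ (hstep 0).1, sub_self]
      rw [eq_C_of_natDegree_eq_zero hd1, eval_C] at he
      exact h1 (h0 ▸ he)
    obtain ⟨i, hi⟩ : ∃ i, ¬ IsTotallyRamifiedAt φ (x i) (x (i + 1)) := by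
      by_contra! hcon
      exact not_three_isTotallyRamifiedAt hd hφ (hxinj.ne (by decide)) (hxinj.ne (by decide))
        (hxinj.ne (by decide)) (hxinj.ne (by decide)) (hcon 0) (hcon 1) (hcon 2)
    obtain ⟨j, h, e, hh, hh0⟩ := exists_eq_pow_mul_of_not_isTotallyRamifiedAt (hinf (i + 1)) hi
    refine false_of_orbit hN (x := fun m => x (i + m)) (f := φ.num) (g := φ.denom)
      (fun a b hab => by simpa using hxinj hab) φ.isCoprime_num_denom (fun m => (hstep _).1)
      (fun m => (hstep _).2) e hh hh0 (S := {𝔭 | ¬ HasPeriodicReduction φ α 𝔭} ∪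
        {𝔭 | ¬ ∃ ψ, HasGoodReductionTo φ 𝔭 ψ} ∪ {𝔭 | ¬ 𝔭.valuation F (x i) ≤ 1} ∪
        {𝔭 | ¬ 𝔭.valuation F (x (i + 1)) ≤ 1})
      (((hfin.union (finite_setOf_bad_reduction φ)).union
        (finite_setOf_one_lt_valuation _)).union (finite_setOf_one_lt_valuation _)) ?_
    intro 𝔭 hp m hm hm1
    simp only [Set.mem_union, Set.mem_ofPred_eq, not_or, not_not] at hp
    obtain ⟨⟨⟨p0, p1⟩, p2⟩, p3⟩ := hp
    refine (reduce_coe_eq_reduce_coe_iff 𝔭 hm p2).mp ?_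
    have hm2 : 𝔭.valuation F (x (i + (m + 1))) ≤ 1 := by
      have := Valuation.map_add_le (𝔭.valuation F) hm1.le p3
      rwa [sub_add_cancel] at this
    have := (reduce_coe_eq_reduce_coe_iff 𝔭 hm2 p3).mpr hm1
    simp only [← hx] at this ⊢
    exact p0.reduce_iterate_injective p1 this
  · -- the orbit is finite, so that reduction is injective on it at almost all primes
    have hrange : (Set.range P).Finite := by
      simp only [Function.Injective, not_forall] at hinj
      obtain ⟨a, b, hab, hne⟩ := hinj
      wlog hlt : a < b generalizing a b
      · exact this b a hab.symm (Ne.symm hne) (by omega)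
      refine (Set.Finite.image P (Set.finite_Iio b)).subset ?_
      rintro _ ⟨n, rfl⟩
      induction n using Nat.strong_induction_on with
      | _ n ih =>
        rcases lt_or_ge n b with hn | hn
        · exact ⟨n, hn, rfl⟩
        · have : P n = P (n - b + a) := by
            conv_lhs => rw [show n = n - b + b by omega]
            simp only [hP, Function.iterate_add_apply] at hab ⊢
            rw [hab]
          rw [this]
          exact ih _ (by omega)
    have hcoll : (⋃ Q ∈ Set.range P ×ˢ Set.range P,
        {𝔭 : HeightOneSpectrum o | Q.1 ≠ Q.2 ∧ reduce 𝔭 Q.1 = reduce 𝔭 Q.2}).Finite := by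
      refine (hrange.prod hrange).biUnion fun Q _ => ?_
      by_cases hQ : Q.1 = Q.2
      · simp [hQ]
      · exact (finite_setOf_reduce_eq hQ).subset fun 𝔭 h => h.2
    obtain ⟨𝔭, hp⟩ := (hfin.union hcoll).exists_notMem
    simp only [Set.mem_union, not_or, Set.mem_ofPred_eq, not_not] at hp
    obtain ⟨n, hn, e⟩ := hp.1.exists_reduce_iterate_eq
    refine hα ⟨n, hn, ?_⟩
    by_contra hne
    exact hp.2 (Set.mem_biUnion (x := (P n, P 0)) ⟨⟨n, rfl⟩, ⟨0, rfl⟩⟩ ⟨hne, e⟩)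

end Orbits
/-! ### Integral closures in inseparable extensions -/

section Dedekind

open scoped nonZeroDivisors

/-- The integral closure of a Dedekind domain in a finite, possibly inseparable, extension `L` of
its fraction field is a Dedekind domain. Only the noetherian property needs an argument. Let `D` be
the integral closure in the separable closure `M`, which is a Dedekind domain, and let `q` be such
that `L ^ q ⊆ M`. For a nonzero ideal `I`, the ideal `J` of `D` generated by the `a ^ q`, `a ∈ I`,
is invertible, so that `1` is a sum of terms `c * a ^ q` with `c ∈ J⁻¹`. Then `c * a ^ (q - 1)`
multiplies `I` into the integral closure, hence `I` is invertible and finitely generated. -/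
theorem isDedekindDomain_integralClosure (A K L : Type*) [CommRing A] [IsDedekindDomain A] [Field K]
    [Algebra A K] [IsFractionRing A K] [Field L] [Algebra K L] [Algebra A L] [IsScalarTower A K L]
    [FiniteDimensional K L] : IsDedekindDomain (integralClosure A L) := by
  have hfrac : IsFractionRing (integralClosure A L) L :=
    integralClosure.isFractionRing_of_finite_extension K L
  set M := separableClosure K L with hM
  have htower : IsScalarTower A M L :=
    .of_algebraMap_eq fun x => by
      rw [IsScalarTower.algebraMap_apply A K M, ← IsScalarTower.algebraMap_apply K M L,
        ← IsScalarTower.algebraMap_apply A K L]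
  have hD : IsDedekindDomain (integralClosure A M) := integralClosure.isDedekindDomain A K M
  have hDfrac : IsFractionRing (integralClosure A M) M :=
    integralClosure.isFractionRing_of_finite_extension K M
  set q := ringExpChar M ^ IsPurelyInseparable.exponent M L with hq
  have hq0 : 0 < q := pow_pos (expChar_pos M (ringExpChar M)) _
  have hpow : ∀ a : integralClosure A L, ∃ d : integralClosure A M,
      algebraMap M L (d : M) = (a : L) ^ q := fun a => by
    obtain ⟨m, hm⟩ := IsPurelyInseparable.exponent_def M (a : L)
    refine ⟨⟨m, ?_⟩, hm⟩
    have : IsIntegral A (algebraMap M L m) := by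
      rw [hm]
      exact IsIntegral.pow a.2 q
    exact (isIntegral_algebraMap_iff (algebraMap M L).injective).mp this
  have hnoeth : IsNoetherianRing (integralClosure A L) := by
    refine (isNoetherianRing_iff_ideal_fg _).mpr fun I => ?_
    by_cases hI : I = ⊥
    · rw [hI]; exact Submodule.fg_bot
    let N : Submodule (integralClosure A L) L :=
      Submodule.map (Algebra.linearMap (integralClosure A L) L) I
    let J : Ideal (integralClosure A M) :=
      Ideal.span {d | ∃ a ∈ I, algebraMap M L (d : M) = (a : L) ^ q}
    have hJ : J ≠ ⊥ := by
      obtain ⟨a, ha, ha0⟩ := Submodule.exists_mem_ne_zero_of_ne_bot hI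
      obtain ⟨d, hd⟩ := hpow a
      intro h0
      have hdJ : d ∈ J := Ideal.subset_span ⟨a, ha, hd⟩
      rw [h0, Ideal.mem_bot] at hdJ
      rw [hdJ] at hd
      have := pow_eq_zero_iff hq0.ne' |>.mp (hd.symm.trans (by simp))
      exact ha0 (by simpa using this)
    have hJ0 : (J : FractionalIdeal (integralClosure A M)⁰ M) ≠ 0 :=
      FractionalIdeal.coeIdeal_ne_zero.mpr hJ
    have hint : ∀ d ∈ J, ∀ c ∈ (J : FractionalIdeal (integralClosure A M)⁰ M)⁻¹,
        IsIntegral A (algebraMap M L (c * d)) := fun d hd c hc => by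
      have h1 := (FractionalIdeal.mem_inv_iff hJ0).mp hc (d : M)
        (FractionalIdeal.mem_coeIdeal_of_mem _ hd)
      obtain ⟨r, hr⟩ := (FractionalIdeal.mem_one_iff _).mp h1
      rw [← hr]
      exact r.2.algebraMap
    have key : ∀ d ∈ J, ∀ c ∈ (J : FractionalIdeal (integralClosure A M)⁰ M)⁻¹,
        algebraMap M L (d * c) ∈ N * (1 / N) := fun d hd => by
      refine Submodule.span_induction (p := fun (d : integralClosure A M) _ =>
        ∀ c ∈ (J : FractionalIdeal (integralClosure A M)⁰ M)⁻¹,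
          algebraMap M L ((d : M) * c) ∈ N * (1 / N)) ?_ ?_ ?_ ?_ hd
      · rintro d ⟨a, ha, hda⟩ c hc
        have haN : (a : L) ∈ N := ⟨a, ha, rfl⟩
        have hb : (a : L) ^ (q - 1) * algebraMap M L c ∈ 1 / N := by
          rw [Submodule.mem_div_iff_forall_mul_mem]
          rintro _ ⟨x, hx, rfl⟩
          obtain ⟨e, he⟩ := hpow x
          have hbx : IsIntegral A ((a : L) ^ (q - 1) * algebraMap M L c * (x : L)) := by
            refine IsIntegral.of_pow hq0 ?_
            have h1 := hint d (Ideal.subset_span ⟨a, ha, hda⟩) c hc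
            have h2 := hint e (Ideal.subset_span ⟨x, hx, he⟩) c hc
            have e3 : ((a : L) ^ (q - 1) * algebraMap M L c * (x : L)) ^ q =
                algebraMap M L (c * d) ^ (q - 1) * algebraMap M L (c * e) := by
              obtain ⟨k, hk⟩ : ∃ k, q = k + 1 := ⟨q - 1, by omega⟩
              rw [map_mul, map_mul, hda, he, hk]
              simp only [add_tsub_cancel_right]
              ring
            rw [e3]
            exact (h1.pow _).mul h2
          exact Submodule.mem_one.mpr ⟨⟨_, hbx⟩, rfl⟩
        have e4 : algebraMap M L ((d : M) * c) =
            (a : L) * ((a : L) ^ (q - 1) * algebraMap M L c) := by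
          rw [map_mul, hda, ← mul_assoc, mul_pow_sub_one hq0.ne']
        rw [e4]
        exact Submodule.mul_mem_mul haN hb
      · intro c _
        simp
      · intro x y _ _ hx hy c hc
        have : algebraMap M L (((x + y : integralClosure A M) : M) * c) =
            algebraMap M L ((x : M) * c) + algebraMap M L ((y : M) * c) := by
          rw [← map_add, ← add_mul]; rfl
        rw [this]
        exact Submodule.add_mem _ (hx c hc) (hy c hc)
      · intro r x _ hx c hc
        have := hx (r • c) (Submodule.smul_mem _ r hc)
        convert this using 2
        rw [Algebra.smul_def r c, smul_eq_mul]
        change (r : M) * x * c = x * (r * c)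
        ring
    have hone : (1 : L) ∈ N * (1 / N) := by
      have h1 : (1 : M) ∈ (J : FractionalIdeal (integralClosure A M)⁰ M) *
          (J : FractionalIdeal (integralClosure A M)⁰ M)⁻¹ := by
        rw [mul_inv_cancel₀ hJ0]
        exact FractionalIdeal.one_mem_one _
      rw [← FractionalIdeal.mem_coe, FractionalIdeal.coe_mul] at h1
      rw [← map_one (algebraMap M L)]
      refine Submodule.mul_induction_on (C := fun z => algebraMap M L z ∈ N * (1 / N)) h1 ?_ ?_
      · intro y hy c hc
        obtain ⟨d, hd, rfl⟩ := (FractionalIdeal.mem_coeIdeal _).mp hy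
        exact key d hd c hc
      · intro y z hy hz
        rw [map_add]
        exact Submodule.add_mem _ hy hz
    have hunit : IsUnit N := .of_mul_eq_one (1 / N)
      (le_antisymm Submodule.mul_one_div_le_one (Submodule.one_le.mpr hone))
    exact Submodule.fg_of_fg_map_injective _ (FaithfulSMul.algebraMap_injective _ L)
      (Submodule.fg_of_isUnit hunit)
  have hdim : Ring.DimensionLEOne (integralClosure A L) := inferInstance
  have hic : IsIntegrallyClosed (integralClosure A L) :=
    integralClosure.isIntegrallyClosedOfFiniteExtension K
  exact { hnoeth, hdim, hic with }

end Dedekind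

/-! ### Finiteness of bounded sets -/

section Finiteness

section AdicAbs

variable {o F : Type*} [CommRing o] [Field F] [Algebra o F] [IsDedekindDomain o]
  [IsFractionRing o F]

theorem adicAbv_le_one_iff (𝔭 : HeightOneSpectrum o) {b : NNReal} (hb : 1 < b) (x : F) :
    𝔭.adicAbv hb x ≤ 1 ↔ 𝔭.valuation F x ≤ 1 := by
  have h := (WithZeroMulInt.toNNReal_strictMono hb).le_iff_le (a := 𝔭.valuation F x) (b := 1)
  rw [map_one] at h
  rw [← h]
  exact NNReal.coe_le_one

/-- If `x` is topologically nilpotent at all absolute values of a finite set, multiplication by a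
high power of `x` moves any ball into the unit ball, simultaneously for all of them. -/
theorem exists_forall_abv_pow_mul_le_one {ι : Type*} {s : Set ι} (hs : s.Finite)
    (v : ι → AbsoluteValue F ℝ) {x : F} (hx : ∀ i ∈ s, v i x < 1) (B : ℝ) :
    ∃ n : ℕ, ∀ i ∈ s, ∀ t, v i t ≤ B → v i (x ^ n * t) ≤ 1 := by
  have : ∀ᶠ n : ℕ in Filter.atTop, ∀ i ∈ s, v i x ^ n * |B| < 1 :=
    (Filter.eventually_all_finite hs).mpr fun i hi => by
      have h := (tendsto_pow_atTop_nhds_zero_of_lt_one ((v i).nonneg x) (hx i hi)).mul_const |B|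
      rw [zero_mul] at h
      exact h.eventually_lt_const one_pos
  obtain ⟨n, hn⟩ := this.exists
  refine ⟨n, fun i hi t ht => ?_⟩
  rw [map_mul, map_pow]
  exact (mul_le_mul_of_nonneg_left (ht.trans (le_abs_self B))
    (pow_nonneg ((v i).nonneg x) n)).trans (hn i hi).le

/-- It suffices to treat `S = ∅`: otherwise add the absolute values of the primes in `S` and clear
denominators. -/
theorem hasFiniteBoundedSets_of_integral (V₀ : Finset (AbsoluteValue F ℝ))
    (hV₀ : ∀ B : ℝ, {t : F | (∀ 𝔭 : HeightOneSpectrum o, 𝔭.valuation F t ≤ 1) ∧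
      ∀ v ∈ V₀, v t ≤ B}.Finite) : HasFiniteBoundedSets o F := by
  classical
  intro S hS
  choose n hn hn0 using fun 𝔭 : HeightOneSpectrum o =>
    Submodule.exists_mem_ne_zero_of_ne_bot 𝔭.ne_bot
  set N : o := ∏ 𝔭 ∈ hS.toFinset, n 𝔭 with hN
  have hN0 : algebraMap o F N ≠ 0 := (map_ne_zero_iff _ (IsFractionRing.injective o F)).mpr
    (Finset.prod_ne_zero_iff.mpr fun 𝔭 _ => hn0 𝔭)
  have hNS : ∀ 𝔭 ∈ S, 𝔭.adicAbv one_lt_two (algebraMap o F N) < 1 := fun 𝔭 hp => by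
    rw [HeightOneSpectrum.adicAbv_coe_lt_one_iff]
    exact Ideal.mem_of_dvd _ (Finset.dvd_prod_of_mem n (hS.mem_toFinset.mpr hp)) (hn 𝔭)
  refine ⟨V₀ ∪ hS.toFinset.image fun 𝔭 => 𝔭.adicAbv one_lt_two, fun B => ?_⟩
  obtain ⟨k, hk⟩ := exists_forall_abv_pow_mul_le_one hS (fun 𝔭 => 𝔭.adicAbv one_lt_two) hNS B
  have hN1 : ∀ 𝔭 : HeightOneSpectrum o, 𝔭.valuation F (algebraMap o F N ^ k) ≤ 1 := fun 𝔭 => by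
    rw [← map_pow]
    exact 𝔭.valuation_le_one _
  refine Set.Finite.of_finite_image ((hV₀ (∑ v ∈ V₀, |v (algebraMap o F N ^ k) * B|)).subset ?_)
    (f := fun t => algebraMap o F N ^ k * t) (mul_right_injective₀ (pow_ne_zero k hN0)).injOn
  rintro _ ⟨t, ⟨ht, ht'⟩, rfl⟩
  refine ⟨fun 𝔭 => ?_, fun v hv => ?_⟩
  · by_cases hp : 𝔭 ∈ S
    · rw [← adicAbv_le_one_iff 𝔭 one_lt_two]
      exact hk 𝔭 hp t (ht' _ (Finset.mem_union_right _
        (Finset.mem_image_of_mem _ (hS.mem_toFinset.mpr hp))))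
    · rw [map_mul]
      exact mul_le_one' (hN1 𝔭) (ht 𝔭 hp)
  · rw [map_mul]
    exact (mul_le_mul_of_nonneg_left (ht' v (Finset.mem_union_left _ hv)) (v.nonneg _)).trans
      ((le_abs_self _).trans (Finset.single_le_sum (f := fun v => |v (algebraMap o F N ^ k) * B|)
        (fun _ _ => abs_nonneg _) hv))

/-- Euclid: if there were finitely many primes, `1 + R N` would consist of units for a nonzero `N`
in all of them. -/
theorem infinite_heightOneSpectrum_of_finite_units (R : Type*) [CommRing R] [IsDomain R]
    [Ring.DimensionLEOne R] [Finite Rˣ] (hR : ¬ IsField R) : Infinite (HeightOneSpectrum R) := by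
  by_contra hcon
  rw [not_infinite_iff_finite] at hcon
  have : Infinite R := by
    by_contra h
    rw [not_infinite_iff_finite] at h
    exact hR (Finite.isField_of_domain R)
  have := Fintype.ofFinite (HeightOneSpectrum R)
  choose n hn hn0 using fun 𝔭 : HeightOneSpectrum R =>
    Submodule.exists_mem_ne_zero_of_ne_bot 𝔭.ne_bot
  set N : R := ∏ 𝔭, n 𝔭 with hN
  have hN0 : N ≠ 0 := Finset.prod_ne_zero_iff.mpr fun 𝔭 _ => hn0 𝔭
  have hunit : ∀ r : R, IsUnit (1 + r * N) := fun r => by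
    by_contra h
    obtain ⟨m, hm, hmem⟩ := exists_max_ideal_of_mem_nonunits h
    have hm0 : m ≠ ⊥ := Ring.ne_bot_of_isMaximal_of_not_isField hm hR
    let 𝔭 : HeightOneSpectrum R := ⟨m, hm.isPrime, hm0⟩
    have hNm : N ∈ m := Ideal.mem_of_dvd m (Finset.dvd_prod_of_mem n (Finset.mem_univ 𝔭)) (hn 𝔭)
    refine hm.ne_top ((Ideal.eq_top_iff_one m).mpr ?_)
    have := m.sub_mem hmem (m.mul_mem_left r hNm)
    rwa [add_sub_cancel_right] at this
  have hinj : Function.Injective fun r : R => (hunit r).unit := fun r s h => by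
    have := congrArg Units.val h
    simpa [hN0] using this
  exact (Finite.of_injective _ hinj).not_infinite inferInstance

theorem infinite_heightOneSpectrum_of_isIntegral (R C : Type*) [CommRing R]
    [IsDedekindDomain R] [CommRing C] [Algebra R C] [Algebra.IsIntegral R C]
    (hinj : Function.Injective (algebraMap R C)) [Infinite (HeightOneSpectrum R)] :
    Infinite (HeightOneSpectrum C) := by
  have : ∀ 𝔭 : HeightOneSpectrum R, ∃ 𝔓 : HeightOneSpectrum C,
      𝔓.asIdeal.comap (algebraMap R C) = 𝔭.asIdeal := fun 𝔭 => by
    have := 𝔭.isMaximal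
    obtain ⟨Q, hQ, e⟩ := Ideal.exists_ideal_over_maximal_of_isIntegral (S := C) 𝔭.asIdeal
      (by rw [(RingHom.injective_iff_ker_eq_bot _).mp hinj]; exact bot_le)
    refine ⟨⟨Q, hQ.isPrime, fun h0 => 𝔭.ne_bot ?_⟩, e⟩
    rw [← e, h0]
    exact (RingHom.injective_iff_ker_eq_bot _).mp hinj
  choose P hP using this
  exact Infinite.of_injective P fun a b h => HeightOneSpectrum.ext (by rw [← hP, h, hP])

end AdicAbs

section NumberField

variable (F : Type*) [Field F] [NumberField F]

theorem hasFiniteBoundedSets_numberField :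
    HasFiniteBoundedSets (NumberField.RingOfIntegers F) F := by
  classical
  refine hasFiniteBoundedSets_of_integral
    (Finset.univ.image fun σ : F →+* ℂ => NumberField.place σ) fun B =>
      (NumberField.Embeddings.finite_of_norm_le F ℂ B).subset ?_
  rintro t ⟨h1, h2⟩
  obtain ⟨r, rfl⟩ := HeightOneSpectrum.mem_integers_of_valuation_le_one F t h1
  exact ⟨r.isIntegral_coe,
    fun σ => h2 _ (Finset.mem_image_of_mem _ (Finset.mem_univ σ))⟩

theorem infinite_heightOneSpectrum_numberField :
    Infinite (HeightOneSpectrum (NumberField.RingOfIntegers F)) := by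
  have := infinite_heightOneSpectrum_of_finite_units ℤ Int.not_isField
  exact infinite_heightOneSpectrum_of_isIntegral ℤ _ (FaithfulSMul.algebraMap_injective _ _)

end NumberField

section FunctionField

variable (k : Type*) [Field k] [Finite k]

theorem finite_setOf_natDegree_le (n : ℕ) : {f : k[X] | f.natDegree ≤ n}.Finite := by
  refine Set.Finite.of_finite_image (f := fun f (i : Fin (n + 1)) => f.coeff i) (Set.toFinite _) ?_
  intro f hf g hg e
  ext i
  by_cases hi : i < n + 1
  · exact congrFun e ⟨i, hi⟩
  · rw [coeff_eq_zero_of_natDegree_lt, coeff_eq_zero_of_natDegree_lt]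
    · exact lt_of_le_of_lt hg (by omega)
    · exact lt_of_le_of_lt hf (by omega)

theorem infinite_heightOneSpectrum_polynomial : Infinite (HeightOneSpectrum k[X]) := by
  have : Finite k[X]ˣ := by
    refine Finite.of_injective (fun u : k[X]ˣ => (u : k[X]).coeff 0) fun u w h => ?_
    ext1
    rw [eq_C_of_natDegree_eq_zero (natDegree_eq_zero_of_isUnit u.isUnit),
      eq_C_of_natDegree_eq_zero (natDegree_eq_zero_of_isUnit w.isUnit)]
    exact congrArg C h
  exact infinite_heightOneSpectrum_of_finite_units _ (Polynomial.not_isField k)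

variable (F : Type*) [Field F] [Algebra k[X] F] [Algebra (RatFunc k) F]
  [IsScalarTower k[X] (RatFunc k) F] [FunctionField k F]

open scoped Classical in
/-- Elements of `F` integral over `k[X]` with a pole of bounded order at infinity (so that
`X⁻ⁿ t` is integral over the valuation ring `A` of `k(X)` at infinity) are finite in number: the
minimal polynomial of `t` has coefficients in `k[X]` of bounded degree. -/
theorem finite_setOf_isIntegral_of_isIntegral_infty (n : ℕ) :
    {t : F | IsIntegral k[X] t ∧ IsIntegral (RatFunc.inftyValuation k).valuationSubring
      (algebraMap (RatFunc k) F (RatFunc.X⁻¹ ^ n) * t)}.Finite := by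
  set d := Module.finrank (RatFunc k) F with hd
  refine (bUnion_roots_finite (algebraMap k[X] F) d (finite_setOf_natDegree_le k (n * d))).subset ?_
  rintro t ⟨h1, h2⟩
  have e1 := minpoly.isIntegrallyClosed_eq_field_fractions' (RatFunc k) h1
  have e2 := minpoly.isIntegrallyClosed_eq_field_fractions' (RatFunc k) h2
  have h1' : IsIntegral (RatFunc k) t := h1.tower_top
  have e3 := IsIntegrallyClosed.minpoly_smul (R := RatFunc k) (r := RatFunc.X⁻¹ ^ n)
    (pow_ne_zero n (inv_ne_zero RatFunc.X_ne_zero)) h1'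
  rw [Algebra.smul_def] at e3
  have hdeg : (minpoly k[X] t).natDegree = (minpoly (RatFunc k) t).natDegree := by
    rw [e1, natDegree_map_eq_of_injective (IsFractionRing.injective k[X] (RatFunc k))]
  have hle : (minpoly k[X] t).natDegree ≤ d := hdeg.trans_le (minpoly.natDegree_le t)
  simp only [Set.mem_iUnion]
  refine ⟨minpoly k[X] t, ⟨hle, fun i => ?_⟩, ?_⟩
  · set D := (minpoly k[X] t).natDegree with hD
    have hc : RatFunc.inftyValuation k
        ((minpoly (RatFunc k) (algebraMap (RatFunc k) F (RatFunc.X⁻¹ ^ n) * t)).coeff i) ≤ 1 := by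
      rw [e2, coeff_map]
      exact ((minpoly (RatFunc.inftyValuation k).valuationSubring _).coeff i).2
    rw [e3, coeff_scaleRoots, ← hdeg, e1, coeff_map] at hc
    by_cases h0 : (minpoly k[X] t).coeff i = 0
    · rw [h0]
      simp
    rw [map_mul, RatFunc.inftyValuation_apply, RatFunc.inftyValuation.polynomial k h0, map_pow,
      map_pow, map_inv₀, RatFunc.inftyValuation.X, ← WithZero.exp_neg, ← WithZero.exp_nsmul, ← WithZero.exp_nsmul,
      ← WithZero.exp_add, ← WithZero.exp_zero, WithZero.exp_le_exp] at hc
    simp only [nsmul_eq_mul] at hc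
    have hz : (((minpoly k[X] t).coeff i).natDegree : ℤ) ≤ n * (D - i : ℕ) := by linarith
    have hz' : ((minpoly k[X] t).coeff i).natDegree ≤ n * (D - i) := by exact_mod_cast hz
    exact hz'.trans (Nat.mul_le_mul_left n ((Nat.sub_le _ _).trans hle))
  · rw [Finset.mem_coe, Multiset.mem_toFinset, mem_roots ((minpoly.monic h1).map _).ne_zero,
      IsRoot.def, eval_map_algebraMap]
    exact minpoly.aeval _ _

open scoped Classical in
/-- The places at infinity are the primes of the integral closure `C` of the valuation ring of
`k(X)` at infinity. -/
theorem hasFiniteBoundedSets_functionField [IsDedekindDomain (FunctionField.ringOfIntegers k F)] :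
    HasFiniteBoundedSets (FunctionField.ringOfIntegers k F) F := by
  let A := (RatFunc.inftyValuation k).valuationSubring
  let C := integralClosure A F
  have hC : IsDedekindDomain C := isDedekindDomain_integralClosure A (RatFunc k) F
  have hfrac : IsFractionRing C F :=
    integralClosure.isFractionRing_of_finite_extension (RatFunc k) F
  have hval : RatFunc.inftyValuation k RatFunc.X⁻¹ < 1 := by
    rw [map_inv₀, RatFunc.inftyValuation.X, ← WithZero.exp_neg, ← WithZero.exp_zero,
      WithZero.exp_lt_exp]
    simp
  let ϖ : A := ⟨RatFunc.X⁻¹, hval.le⟩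
  have hϖ0 : ϖ ≠ 0 := fun h0 =>
    inv_ne_zero (RatFunc.X_ne_zero (K := k)) (congrArg Subtype.val h0)
  have hϖ : ϖ ∈ IsLocalRing.maximalIdeal A := by
    rw [IsLocalRing.mem_maximalIdeal, mem_nonunits_iff]
    exact fun h => ((Valuation.Integers.isUnit_iff_valuation_eq_one
      (Valuation.integer.integers (RatFunc.inftyValuation k))).mp h).not_lt hval
  have hmem : ∀ 𝔓 : HeightOneSpectrum C, algebraMap A C ϖ ∈ 𝔓.asIdeal := fun 𝔓 => by
    have := 𝔓.isMaximal
    have hm := Ideal.isMaximal_comap_of_isIntegral_of_isMaximal (R := A) 𝔓.asIdeal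
    have := IsLocalRing.eq_maximalIdeal hm
    rw [← Ideal.mem_comap, this]
    exact hϖ
  have hinj : Function.Injective (algebraMap A C) := by
    have : Function.Injective (algebraMap A F) := by
      rw [IsScalarTower.algebraMap_eq A (RatFunc k) F]
      exact (algebraMap (RatFunc k) F).injective.comp (IsFractionRing.injective A (RatFunc k))
    exact fun x y h => this (by
      rw [IsScalarTower.algebraMap_apply A C F, h, ← IsScalarTower.algebraMap_apply A C F])
  have hfin : Finite (HeightOneSpectrum C) := by
    rw [← Set.finite_univ_iff]
    exact (finite_setOf_mem_asIdeal ((map_ne_zero_iff _ hinj).mpr hϖ0)).subset fun 𝔓 _ => hmem 𝔓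
  have := Fintype.ofFinite (HeightOneSpectrum C)
  refine hasFiniteBoundedSets_of_integral
    (Finset.univ.image fun 𝔓 : HeightOneSpectrum C => 𝔓.adicAbv one_lt_two) fun B => ?_
  obtain ⟨n, hn⟩ := exists_forall_abv_pow_mul_le_one (Set.finite_univ)
    (fun 𝔓 : HeightOneSpectrum C => 𝔓.adicAbv (K := F) one_lt_two)
    (x := algebraMap C F (algebraMap A C ϖ))
    (fun 𝔓 _ => (HeightOneSpectrum.adicAbv_coe_lt_one_iff 𝔓 one_lt_two _).mpr (hmem 𝔓)) B
  refine (finite_setOf_isIntegral_of_isIntegral_infty k F n).subset ?_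
  rintro t ⟨h1, h2⟩
  obtain ⟨r, hr⟩ := HeightOneSpectrum.mem_integers_of_valuation_le_one F t h1
  refine ⟨hr ▸ r.2, ?_⟩
  obtain ⟨s, hs⟩ := HeightOneSpectrum.mem_integers_of_valuation_le_one (R := C) F
    (algebraMap C F (algebraMap A C ϖ) ^ n * t) fun 𝔓 =>
      (adicAbv_le_one_iff 𝔓 one_lt_two _).mp
        (hn 𝔓 (Set.mem_univ _) t (h2 _ (Finset.mem_image_of_mem _ (Finset.mem_univ 𝔓))))
  have e : algebraMap (RatFunc k) F (RatFunc.X⁻¹ ^ n) * t = algebraMap C F s := by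
    rw [hs, map_pow]
    rfl
  rw [e]
  exact s.2

theorem isDedekindDomain_ringOfIntegers_functionField (k F : Type*) [Field k] [Field F]
    [Algebra k[X] F] [Algebra (RatFunc k) F] [IsScalarTower k[X] (RatFunc k) F]
    [FunctionField k F] : IsDedekindDomain (FunctionField.ringOfIntegers k F) :=
  isDedekindDomain_integralClosure k[X] (RatFunc k) F

theorem infinite_heightOneSpectrum_functionField (k F : Type*) [Field k] [Finite k] [Field F]
    [Algebra k[X] F] [Algebra (RatFunc k) F] [IsScalarTower k[X] (RatFunc k) F] :
    Infinite (HeightOneSpectrum (FunctionField.ringOfIntegers k F)) := by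
  have := infinite_heightOneSpectrum_polynomial k
  have : Algebra.IsIntegral k[X] (FunctionField.ringOfIntegers k F) :=
    IsIntegralClosure.isIntegral_algebra k[X] F
  exact infinite_heightOneSpectrum_of_isIntegral k[X] _
    (FunctionField.ringOfIntegers.algebraMap_injective k F)

end FunctionField

end Finiteness

end GlobalDynamics

theorem mainTheorem6 :
    -- `F` is a number field
    (∀ (F : Type*) [Field F] [NumberField F] (φ : RatFunc F) (α : F),
      2 ≤ GlobalDynamics.ratDegree φ →
      ¬ GlobalDynamics.IsPeriodicPoint φ (α : OnePoint F) →
      {𝔭 : HeightOneSpectrum (NumberField.RingOfIntegers F) |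
        ¬ GlobalDynamics.HasPeriodicReduction φ α 𝔭}.Infinite) ∧
    -- `F` is a finite extension of `𝔽_p(t)`
    (∀ (p : ℕ) [Fact p.Prime] (F : Type*) [Field F] [Algebra (ZMod p)[X] F]
      [Algebra (RatFunc (ZMod p)) F] [IsScalarTower (ZMod p)[X] (RatFunc (ZMod p)) F]
      [FunctionField (ZMod p) F] (φ : RatFunc F) (α : F),
      2 ≤ GlobalDynamics.ratSepDegree φ →
      ¬ GlobalDynamics.IsPeriodicPoint φ (α : OnePoint F) →
      {𝔭 : HeightOneSpectrum (FunctionField.ringOfIntegers (ZMod p) F) |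
        ¬ GlobalDynamics.HasPeriodicReduction φ α 𝔭}.Infinite) := by
  refine ⟨fun F _ _ φ α hφ hα => ?_, fun p _ F _ _ _ _ _ φ α hφ hα => ?_⟩
  · have := GlobalDynamics.infinite_heightOneSpectrum_numberField F
    exact GlobalDynamics.infinite_setOf_not_hasPeriodicReduction
      (GlobalDynamics.hasFiniteBoundedSets_numberField F) (.inl ⟨inferInstance, hφ⟩) hα
  · have := GlobalDynamics.isDedekindDomain_ringOfIntegers_functionField (ZMod p) F
    have := GlobalDynamics.infinite_heightOneSpectrum_functionField (ZMod p) F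
    exact GlobalDynamics.infinite_setOf_not_hasPeriodicReduction
      (GlobalDynamics.hasFiniteBoundedSets_functionField (ZMod p) F) (.inr hφ) hα
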